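/- Let $(\mathbb{G},+)$ be a compact Hausdorff abelian group with Haar probability measure $\mu$ and let $\widehat{\mathbb{G}}$ be its dual group, i.e. the group of continuous homomorphisms $\xi\colon\mathbb{G}\to\mathbb{R}/\mathbb{Z}$. Write $\|\cdot\|_{\mathbb{R}/\mathbb{Z}}$ for the distance to the nearest integer. For a nonempty finite set $S\subseteq\widehat{\mathbb{G}}$ and $\rho\in(0,1]$ let $\nu_{S,\rho}$ be the constant multiple of the function \[ x\mapsto\Big(1-\rho^{-1}\max_{\xi\in S}\|\xi(x)\|_{\mathbb{R}/\mathbb{Z}}\Big)_+ \] that is normalized by $\|\nu_{S,\rho}\|_{L^1(\mathbb{G})}=1$, and let $\chi_{S,\rho}:=\nu_{S,\rho}\ast\nu_{S,\rho}$, where the convolution is with respect to $\mu$. For bounded Borel functions $f,g,h$ on $\mathbb{G}^2$ and $\chi$ on $\mathbb{G}$ let \[ \Lambda_{\chi}(f,g,h):=\int_{\mathbb{G}}\int_{\mathbb{G}}\int_{\mathbb{G}}\int_{\mathbb{G}} f(x,y)\,g(x+s,y+t)\,h(x-t,y+s)\,\chi(s)\,\chi(t)\,d\mu(s)\,d\mu(t)\,d\mu(x)\,d\mu(y).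 \] Theorem. For every $\varepsilon\in(0,1]$ there exists $R(\varepsilon)\in(0,\infty)$ such that the following holds. For every compact Hausdorff abelian group $\mathbb{G}$ that is $2$-divisible (i.e. $x\mapsto 2x$ is a surjection of $\mathbb{G}$ onto itself), with Haar probability measure $\mu$, and every Borel-measurable function $f\colon\mathbb{G}^2\to[0,1]$ there exist a nonempty finite set $S\subseteq\widehat{\mathbb{G}}$ with $|S|\leq R(\varepsilon)$ and a number $\rho\in[R(\varepsilon)^{-1},\varepsilon]$ such that \[ \Lambda_{\chi_{S,\rho}}(f,f,f)\geq\Big(\int_{\mathbb{G}}\int_{\mathbb{G}}f(x,y)\,d\mu(x)\,d\mu(y)\Big)^3-\varepsilon. \] Moreover, if $\mathbb{G}=\mathbb{Z}/N\mathbb{Z}$ (with $N\geq1$ and the discrete topology, $2$-divisible as above), then, with the same $R(\varepsilon)$, the set $S$ and the radius $\rho$ can be chosen so that, in addition, $\chi_{S,\rho}$ is supported in $\{-2\lfloor\rho N\rfloor,\ldots,2\lfloor\rho N\rfloor\}+N\mathbb{Z}$. -/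

import Mathlib

open MeasureTheory
open scoped NNReal

noncomputable section

/-- The group of frequencies of `G`: the continuous homomorphisms `ξ : G → ℝ/ℤ`. -/
abbrev Freq (G : Type*) [AddCommGroup G] [TopologicalSpace G] : Type _ :=
  G →ₜ+ UnitAddCircle

/-- `max_{ξ ∈ S} ‖ξ(x)‖_{ℝ/ℤ}`. The norm on `UnitAddCircle` is the distance to the nearest
integer. -/
def freqMax {G : Type*} [AddCommGroup G] [TopologicalSpace G]
    (S : Finset (Freq G)) (x : G) : ℝ :=
  ((S.sup fun ξ => ‖ξ x‖₊ : ℝ≥0) : ℝ)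

/-- The tent function `x ↦ (1 - ρ⁻¹ max_{ξ ∈ S} ‖ξ(x)‖)₊`, before normalization. It is nonzero
exactly on the Bohr set of `S` and `ρ`. -/
def rawTent {G : Type*} [AddCommGroup G] [TopologicalSpace G]
    (S : Finset (Freq G)) (ρ : ℝ) (x : G) : ℝ :=
  max (1 - ρ⁻¹ * freqMax S x) 0

/-- The tent function `ν_{S,ρ}`: the multiple of the raw tent of `L¹(μ)`-norm one. -/
def tent {G : Type*} [AddCommGroup G] [TopologicalSpace G] [MeasurableSpace G]
    (μ : Measure G) (S : Finset (Freq G)) (ρ : ℝ) (x : G) : ℝ :=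
  (∫ y, |rawTent S ρ y| ∂μ)⁻¹ * rawTent S ρ x

/-- The weight `χ_{S,ρ} = ν_{S,ρ} ∗ ν_{S,ρ}`. -/
def weight {G : Type*} [AddCommGroup G] [TopologicalSpace G] [MeasurableSpace G]
    (μ : Measure G) (S : Finset (Freq G)) (ρ : ℝ) : G → ℝ :=
  MeasureTheory.convolution (tent μ S ρ) (tent μ S ρ) (ContinuousLinearMap.mul ℝ ℝ) μ

/-- The weighted counting form `Λ_χ(f, g, h)`. -/
def countingForm {G : Type*} [AddCommGroup G] [MeasurableSpace G]
    (μ : Measure G) (χ : G → ℝ) (f g h : G × G → ℝ) : ℝ :=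
  ∫ y, ∫ x, ∫ t, ∫ s,
    f (x, y) * g (x + s, y + t) * h (x - t, y + s) * χ s * χ t ∂μ ∂μ ∂μ ∂μ

end

/-! Write z = (x, y) and w = (s, t) in H = G × G, and let J be the quarter turn (s, t) ↦ (-t, s), so
that J² = -1. The counting form is ∫∫ f(z) f(z + w) f(z + Jw) X(w) dz dw with X = N' ∗ N', where N'
is a product of two tents.

Fourier control: a substitution turns the form with U in one slot into ∫∫ U(θ(a + b)) p(a) q(b) X(αa
+ βb), where θ is 1, 1 + J or 1 - J. These maps are surjective because (1 + J)(1 - J) = 2. As X is a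
convolution square, it is an average of products of a function of a and a function of b. What
remains is a bilinear form of a convolution operator, whose norm is at most the largest Fourier
coefficient of U ∘ θ, hence of U. For |p|, |q| ≤ 1 the form is therefore at most sup |Û| (sup N')²
(`norm_integral_selfConv_le`). The operator bound comes from Gelfand theory
(`norm_conv_le_of_fourier`), without completeness of the characters.

Energy pigeonhole: choose thresholds 1 = δ₀ ≥ δ₁ ≥ ..., each small in terms of the previous one, and
let T_j be the set of frequencies where |f̂| ≥ δ_j. By Bessel, one of the first ⌈1024/ε²⌉ shells
T_{j+1} \ T_j has energy at most ε²/1024. Let S contain the coordinates of the frequencies in T_j,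
let N be the product tent of radius ε/256 and N' that of a much smaller radius ρ, and put f₁ = f ∗
N. The coefficients f̂(1 - N̂) of f - f₁ are small on T_j, where N̂ is close to 1, have small energy
on the shell, and are at most 2δ_{j+1} elsewhere. Hence f - f₁ = E + W with E small in L¹ and Ŵ
uniformly small, and f can be replaced by f₁ one slot at a time (`norm_trilinear_sub_le`); δ_{j+1}
is chosen after ρ, so it beats (sup N')². Finally f₁ hardly changes under the shifts w and Jw with w
in the support of X, so its form is nearly at least ∫ f₁³ ≥ (∫ f)³ (`trilinear_ge_of_fourierAt`).

Since G need not be second countable, the Borel σ-algebra of H may exceed the product one. The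
Fourier analysis is therefore done for continuous f; the Borel case follows because the form is
Lipschitz in L¹. -/

set_option linter.unusedSectionVars false

/-! ### Products of compact groups with their Borel σ-algebra -/

/-- The product of two topological groups, equipped with the Borel σ-algebra of the product
topology (which may be larger than the product σ-algebra). -/
def BorelProd (X Y : Type*) := X × Y

namespace BorelProd

variable {X Y : Type*}

instance [AddCommGroup X] [AddCommGroup Y] : AddCommGroup (BorelProd X Y) :=
  inferInstanceAs (AddCommGroup (X × Y))

instance [TopologicalSpace X] [TopologicalSpace Y] : TopologicalSpace (BorelProd X Y) :=
  inferInstanceAs (TopologicalSpace (X × Y))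

instance [TopologicalSpace X] [TopologicalSpace Y] : MeasurableSpace (BorelProd X Y) :=
  borel (BorelProd X Y)

instance [TopologicalSpace X] [TopologicalSpace Y] : BorelSpace (BorelProd X Y) := ⟨rfl⟩

instance [TopologicalSpace X] [TopologicalSpace Y] [CompactSpace X] [CompactSpace Y] :
    CompactSpace (BorelProd X Y) :=
  inferInstanceAs (CompactSpace (X × Y))

instance [TopologicalSpace X] [TopologicalSpace Y] [T2Space X] [T2Space Y] :
    T2Space (BorelProd X Y) :=
  inferInstanceAs (T2Space (X × Y))

instance [AddCommGroup X] [AddCommGroup Y] [TopologicalSpace X] [TopologicalSpace Y]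
    [IsTopologicalAddGroup X] [IsTopologicalAddGroup Y] : IsTopologicalAddGroup (BorelProd X Y) :=
  inferInstanceAs (IsTopologicalAddGroup (X × Y))

/-- The pair `(x, y)` as an element of `BorelProd X Y`. -/
def mk (x : X) (y : Y) : BorelProd X Y := (x, y)

/-- The first coordinate. -/
def fst (p : BorelProd X Y) : X := Prod.fst p

/-- The second coordinate. -/
def snd (p : BorelProd X Y) : Y := Prod.snd p

@[simp] lemma fst_mk (x : X) (y : Y) : (mk x y).fst = x := rfl
@[simp] lemma snd_mk (x : X) (y : Y) : (mk x y).snd = y := rfl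

@[ext] lemma ext {p q : BorelProd X Y} (h₁ : p.fst = q.fst) (h₂ : p.snd = q.snd) : p = q :=
  Prod.ext h₁ h₂

section Group

variable [AddCommGroup X] [AddCommGroup Y]

@[simp] lemma fst_add (p q : BorelProd X Y) : (p + q).fst = p.fst + q.fst := rfl
@[simp] lemma snd_add (p q : BorelProd X Y) : (p + q).snd = p.snd + q.snd := rfl
@[simp] lemma fst_neg (p : BorelProd X Y) : (-p).fst = -p.fst := rfl
@[simp] lemma snd_neg (p : BorelProd X Y) : (-p).snd = -p.snd := rfl
@[simp] lemma fst_sub (p q : BorelProd X Y) : (p - q).fst = p.fst - q.fst := rfl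
@[simp] lemma snd_sub (p q : BorelProd X Y) : (p - q).snd = p.snd - q.snd := rfl

end Group

section Top
variable [TopologicalSpace X] [TopologicalSpace Y]

@[fun_prop] lemma continuous_fst : Continuous (fst : BorelProd X Y → X) :=
  (_root_.continuous_fst : Continuous (Prod.fst : X × Y → X))

@[fun_prop] lemma continuous_snd : Continuous (snd : BorelProd X Y → Y) :=
  (_root_.continuous_snd : Continuous (Prod.snd : X × Y → Y))

@[fun_prop] lemma continuous_mk {Z : Type*} [TopologicalSpace Z] {f : Z → X} {g : Z → Y}
    (hf : Continuous f) (hg : Continuous g) : Continuous fun z => mk (f z) (g z) :=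
  hf.prodMk hg

variable [MeasurableSpace X] [BorelSpace X] [MeasurableSpace Y] [BorelSpace Y]

lemma measurable_mk_left (y : Y) : Measurable fun x : X => mk x y :=
  (continuous_mk continuous_id continuous_const).measurable

/-- The fibre measures of a Borel product depend measurably on the base point. -/
lemma measurable_map_mk [CompactSpace X] [T2Space X]
    (μ : Measure X) [IsProbabilityMeasure μ] [μ.Regular] :
    Measurable fun y : Y => μ.map fun x => mk x y := by
  have : ∀ y : Y, IsProbabilityMeasure (μ.map fun x => mk x y) := fun y =>
    Measure.isProbabilityMeasure_map (measurable_mk_left y).aemeasurable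
  refine Measurable.measure_of_isPiSystem_of_isProbabilityMeasure
    (S := {s : Set (BorelProd X Y) | IsOpen s}) rfl isPiSystem_isOpen ?_
  intro U (hU : IsOpen U)
  -- Inner regularity gives a compact K inside the slice of U at y₀ with measure above a; by the
  -- tube lemma K stays inside the slices at all nearby y.
  have key : LowerSemicontinuous fun y : Y => (μ.map fun x => mk x y) U := by
    intro y₀ a ha
    replace ha : a < (μ.map fun x => mk x y₀) U := ha
    rw [Measure.map_apply (measurable_mk_left y₀) hU.measurableSet] at ha
    obtain ⟨K, hKU, hK, haK⟩ := (hU.preimage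
      (continuous_mk continuous_id continuous_const)).exists_lt_isCompact ha
    have hsub : K ×ˢ ({y₀} : Set Y) ⊆ (U : Set (X × Y)) := by
      rintro ⟨x, y⟩ ⟨hx, rfl⟩
      exact hKU hx
    obtain ⟨V, W, hV, hW, hKV, hyW, hVW⟩ :=
      generalized_tube_lemma hK isCompact_singleton (n := (U : Set (X × Y))) hU hsub
    filter_upwards [hW.mem_nhds (hyW rfl)] with y hy
    change a < (μ.map fun x => mk x y) U
    rw [Measure.map_apply (measurable_mk_left y) hU.measurableSet]
    exact haK.trans_le (measure_mono fun x hx => hVW ⟨hKV hx, hy⟩)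
  exact key.measurable

/-- The product of two measures, defined on all Borel sets. -/
noncomputable def measure (μ : Measure X) (ν : Measure Y) : Measure (BorelProd X Y) :=
  ν.bind fun y => μ.map fun x => mk x y

variable [CompactSpace X] [T2Space X]
  (μ : Measure X) [IsProbabilityMeasure μ] [μ.Regular] (ν : Measure Y) [IsProbabilityMeasure ν]

lemma measure_apply {s : Set (BorelProd X Y)} (hs : MeasurableSet s) :
    measure μ ν s = ∫⁻ y, μ {x | mk x y ∈ s} ∂ν := by
  rw [measure, Measure.bind_apply hs (measurable_map_mk μ).aemeasurable]
  refine lintegral_congr fun y => ?_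
  rw [Measure.map_apply (measurable_mk_left y) hs]
  rfl

instance : IsProbabilityMeasure (measure μ ν) :=
  ⟨by simp [measure_apply μ ν MeasurableSet.univ]⟩

/-- Fubini for functions that are measurable only for the Borel σ-algebra of the product: the
measure is a composition of kernels by construction, and integrals disintegrate along it. -/
lemma integral_measure {E : Type*} [NormedAddCommGroup E] [NormedSpace ℝ E]
    {f : BorelProd X Y → E} (hm : StronglyMeasurable f) (hf : Integrable f (measure μ ν)) :
    ∫ p, f p ∂measure μ ν = ∫ y, ∫ x, f (mk x y) ∂μ ∂ν := by
  let κ : ProbabilityTheory.Kernel Y (BorelProd X Y) := ⟨_, measurable_map_mk μ⟩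
  have hcomp : measure μ ν =
      (ProbabilityTheory.Kernel.comp κ (ProbabilityTheory.Kernel.const Unit ν)) () := by
    rw [ProbabilityTheory.Kernel.comp_apply]
    rfl
  rw [hcomp] at hf ⊢
  rw [ProbabilityTheory.Kernel.integral_comp hf]
  refine integral_congr_ae (.of_forall fun y => ?_)
  exact integral_map (measurable_mk_left y).aemeasurable hm.aestronglyMeasurable

end Top

/-! ### Haar measure on a Borel product -/

section Haar

variable [AddCommGroup X] [AddCommGroup Y] [TopologicalSpace X] [TopologicalSpace Y]
  [IsTopologicalAddGroup X] [IsTopologicalAddGroup Y]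
  [CompactSpace X] [T2Space X] [CompactSpace Y] [T2Space Y]
  [MeasurableSpace X] [BorelSpace X] [MeasurableSpace Y] [BorelSpace Y]
  (μ : Measure X) [IsProbabilityMeasure μ] [μ.IsAddHaarMeasure]
  (ν : Measure Y) [IsProbabilityMeasure ν] [ν.IsAddHaarMeasure]

/-- Invariance of `ν` absorbs the shift of the base point, invariance of `μ` the shift within each
fibre. -/
instance : (measure μ ν).IsAddLeftInvariant := by
  refine ⟨fun g => ?_⟩
  ext s hs
  have hg : Measurable fun p : BorelProd X Y => g + p := (continuous_const_add g).measurable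
  rw [Measure.map_apply hg hs, measure_apply μ ν (hg hs), measure_apply μ ν hs,
    ← lintegral_add_left_eq_self (fun y => μ {x | mk x y ∈ s}) g.snd]
  refine lintegral_congr fun y => ?_
  rw [← measure_preimage_add μ g.fst {x | mk x (g.snd + y) ∈ s}]
  rfl

instance : (measure μ ν).IsAddHaarMeasure :=
  Measure.isAddHaarMeasure_of_isCompact_nonempty_interior _ Set.univ isCompact_univ
    (by simp) (by simp) (by simp)

end Haar

end BorelProd

/-! ### Characters and the norm of convolution operators -/

section Characters

variable {G : Type*} [AddCommGroup G] [TopologicalSpace G]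

/-- The complex exponential `e(ξ(x))` of a frequency. -/
noncomputable def freqExp (ξ : Freq G) (x : G) : ℂ := (AddCircle.toCircle (ξ x) : Circle)

@[fun_prop] lemma continuous_freqExp (ξ : Freq G) : Continuous (freqExp ξ) :=
  continuous_subtype_val.comp (AddCircle.continuous_toCircle.comp (map_continuous ξ))

@[simp] lemma norm_freqExp (ξ : Freq G) (x : G) : ‖freqExp ξ x‖ = 1 := Circle.norm_coe _

lemma freqExp_add (ξ : Freq G) (x y : G) : freqExp ξ (x + y) = freqExp ξ x * freqExp ξ y := by
  simp [freqExp, AddCircle.toCircle_add]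

lemma freqExp_neg (ξ : Freq G) (x : G) : freqExp ξ (-x) = starRingEnd ℂ (freqExp ξ x) := by
  rw [freqExp, map_neg, AddCircle.toCircle_neg, Circle.coe_inv_eq_conj, freqExp]

/-- Every continuous unimodular multiplicative function is the exponential of a frequency. -/
lemma exists_freqExp_eq (c : G → ℂ) (hc : Continuous c) (hadd : ∀ a b, c (a + b) = c a * c b)
    (hnorm : ∀ a, ‖c a‖ = 1) : ∃ ξ : Freq G, ∀ a, freqExp ξ a = c a := by
  let e : UnitAddCircle ≃ₜ Circle := AddCircle.homeomorphCircle one_ne_zero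
  have he : ∀ t : UnitAddCircle, e t = AddCircle.toCircle t := fun t =>
    AddCircle.homeomorphCircle_apply one_ne_zero t
  let d : G → Circle := fun a => ⟨c a, mem_sphere_zero_iff_norm.2 (hnorm a)⟩
  have hd : Continuous d := hc.subtype_mk _
  have hdadd : ∀ a b, d (a + b) = d a * d b := fun a b => Subtype.ext (hadd a b)
  have hsym : ∀ z, AddCircle.toCircle (e.symm z) = z := fun z => by rw [← he]; simp
  let ξ : G →+ UnitAddCircle := AddMonoidHom.mk' (fun a => e.symm (d a)) fun a b => by
    apply e.injective
    simp only [he, AddCircle.toCircle_add, hsym, hdadd]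
  refine ⟨⟨ξ, e.symm.continuous.comp hd⟩, fun a => ?_⟩
  change ((AddCircle.toCircle (e.symm (d a)) : Circle) : ℂ) = c a
  rw [hsym]

end Characters

/-! ### Gelfand theory of a unitary representation -/

section UnitaryRepresentation

variable {H : Type*} [AddCommGroup H] [TopologicalSpace H] [IsTopologicalAddGroup H]
  [CompactSpace H] [MeasurableSpace H] [BorelSpace H]
  {E : Type*} [NormedAddCommGroup E] [InnerProductSpace ℂ E] [CompleteSpace E]

/-- A continuous function on a compact space is integrable for every finite measure, without any
countability assumption. -/
lemma Continuous.integrable_of_compactSpace {X F : Type*} [TopologicalSpace X] [CompactSpace X]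
    [MeasurableSpace X] [OpensMeasurableSpace X] [NormedAddCommGroup F] {μ : Measure X}
    [IsFiniteMeasure μ] {f : X → F} (hf : Continuous f) : Integrable f μ :=
  hf.integrable_of_hasCompactSupport (HasCompactSupport.of_compactSpace f)

/-- A strongly continuous unitary representation of a topological abelian group. -/
structure UnitaryRep (H E : Type*) [AddCommGroup H] [TopologicalSpace H]
    [NormedAddCommGroup E] [InnerProductSpace ℂ E] [CompleteSpace E] where
  /-- The operator attached to a group element. -/
  op : H → E →L[ℂ] E
  op_zero : op 0 = 1
  op_add : ∀ a b, op (a + b) = op a * op b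
  star_op : ∀ a, star (op a) = op (-a)
  continuous_op : ∀ p, Continuous fun a => op a p

namespace UnitaryRep

variable (U : UnitaryRep H E) (μ : Measure H) [IsProbabilityMeasure μ] [μ.IsAddHaarMeasure]

lemma op_mul_comm (a b : H) : U.op a * U.op b = U.op b * U.op a := by
  rw [← U.op_add, add_comm, U.op_add]

lemma norm_op_apply (a : H) (p : E) : ‖U.op a p‖ = ‖p‖ := by
  have h : star (U.op a) * U.op a = 1 := by rw [U.star_op, ← U.op_add]; simp [U.op_zero]
  have h2 : inner ℂ (U.op a p) (U.op a p) = inner ℂ p p := by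
    rw [← ContinuousLinearMap.adjoint_inner_right]
    change inner ℂ p ((star (U.op a) * U.op a) p) = _
    rw [h]; rfl
  rw [inner_self_eq_norm_sq_to_K, inner_self_eq_norm_sq_to_K] at h2
  have h3 : ‖U.op a p‖ ^ 2 = ‖p‖ ^ 2 := by exact_mod_cast h2
  exact (pow_left_inj₀ (norm_nonneg _) (norm_nonneg _) two_ne_zero).1 h3

lemma integrable (F : C(H, ℂ)) (p : E) : Integrable (fun a => F a • U.op a p) μ :=
  (F.continuous.smul (U.continuous_op p)).integrable_of_compactSpace

lemma norm_integral_le (F : C(H, ℂ)) (p : E) : ‖∫ a, F a • U.op a p ∂μ‖ ≤ ‖F‖ * ‖p‖ := by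
  refine (norm_integral_le_of_norm_le_const (C := ‖F‖ * ‖p‖) (.of_forall fun a => ?_)).trans ?_
  · rw [norm_smul, U.norm_op_apply]
    gcongr
    exact F.norm_coe_le_norm a
  · simp

/-- The operator `∫ F(a) U_a da`. -/
noncomputable def conv (F : C(H, ℂ)) : E →L[ℂ] E :=
  LinearMap.mkContinuous
    { toFun := fun p => ∫ a, F a • U.op a p ∂μ
      map_add' := fun p q => by
        rw [← integral_add (U.integrable μ F p) (U.integrable μ F q)]
        simp
      map_smul' := fun c p => by
        rw [RingHom.id_apply, ← integral_smul]
        simp [smul_comm c] } ‖F‖ (U.norm_integral_le μ F)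

lemma conv_apply (F : C(H, ℂ)) (p : E) : U.conv μ F p = ∫ a, F a • U.op a p ∂μ := rfl

lemma norm_conv_le (F : C(H, ℂ)) : ‖U.conv μ F‖ ≤ ‖F‖ :=
  LinearMap.mkContinuous_norm_le _ (norm_nonneg _) _

lemma conv_sub (F F' : C(H, ℂ)) : U.conv μ (F - F') = U.conv μ F - U.conv μ F' := by
  ext p
  simp only [conv_apply, sub_apply, ContinuousMap.sub_apply, sub_smul]
  exact integral_sub (U.integrable μ F p) (U.integrable μ F' p)

lemma continuous_conv : Continuous (U.conv μ) := by
  refine (LipschitzWith.of_dist_le_mul (K := 1) fun F F' => ?_).continuous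
  rw [dist_eq_norm, dist_eq_norm, ← conv_sub, NNReal.coe_one, one_mul]
  exact U.norm_conv_le μ _

lemma commute_op_conv (F : C(H, ℂ)) (b : H) : U.op b * U.conv μ F = U.conv μ F * U.op b := by
  ext p
  simp only [mul_apply_eq_comp, conv_apply]
  rw [← ContinuousLinearMap.integral_comp_comm _ (U.integrable μ F p)]
  refine integral_congr_ae (.of_forall fun a => ?_)
  simp only [map_smul]
  congr 1
  exact DFunLike.congr_fun (U.op_mul_comm b a) p

lemma mul_conv_of_commute (T : E →L[ℂ] E) (hT : ∀ a, U.op a * T = T * U.op a) (F : C(H, ℂ)) :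
    U.conv μ F * T = T * U.conv μ F := by
  ext p
  simp only [mul_apply_eq_comp, conv_apply]
  rw [← ContinuousLinearMap.integral_comp_comm _ (U.integrable μ F p)]
  refine integral_congr_ae (.of_forall fun a => ?_)
  simp only [map_smul]
  congr 1
  exact DFunLike.congr_fun (hT a) p

/-- The function `a ↦ conj (F (-a))`. -/
noncomputable def reflect (F : C(H, ℂ)) : C(H, ℂ) :=
  ⟨fun a => starRingEnd ℂ (F (-a)), by fun_prop⟩

lemma star_conv (F : C(H, ℂ)) : star (U.conv μ F) = U.conv μ (reflect F) := by
  rw [ContinuousLinearMap.star_eq_adjoint, eq_comm, ContinuousLinearMap.eq_adjoint_iff]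
  intro p q
  rw [conv_apply, conv_apply, ← integral_inner (U.integrable μ F q), ← inner_conj_symm,
    ← integral_inner (U.integrable μ (reflect F) p), ← integral_conj, ← integral_neg_eq_self]
  refine integral_congr_ae (.of_forall fun a => ?_)
  simp only [inner_smul_right, reflect, ContinuousMap.coe_mk, neg_neg, map_mul, inner_conj_symm,
    RingHomCompTriple.comp_apply, RingHom.id_apply]
  congr 1
  rw [← U.star_op, ContinuousLinearMap.star_eq_adjoint, ContinuousLinearMap.adjoint_inner_left]

/-- Translates of `F`, as a continuous family. -/
noncomputable def translate (F : C(H, ℂ)) : C(H, C(H, ℂ)) :=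
  ContinuousMap.curry ⟨fun x : H × H => F (x.2 - x.1), by fun_prop⟩

lemma op_mul_conv (F : C(H, ℂ)) (b : H) : U.op b * U.conv μ F = U.conv μ (translate F b) := by
  ext p
  simp only [mul_apply_eq_comp, conv_apply]
  rw [← ContinuousLinearMap.integral_comp_comm _ (U.integrable μ F p),
    ← integral_add_left_eq_self (fun a => (translate F b) a • U.op a p) b]
  refine integral_congr_ae (.of_forall fun a => ?_)
  simp [translate, U.op_add]

/-- The operators `U.op b` are only strongly continuous in `b`. Multiplied by `U.conv μ F` they
become norm continuous, since the shift moves onto `F` and translates of `F` vary continuously in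
sup norm. -/
lemma continuous_op_mul_conv (F : C(H, ℂ)) : Continuous fun b => U.op b * U.conv μ F := by
  simp only [op_mul_conv]
  exact (U.continuous_conv μ).comp (translate F).continuous

/-- The commuting operators generated by the representation and its integrated form. -/
def opSet : Set (E →L[ℂ] E) := Set.range U.op ∪ Set.range (U.conv μ)

lemma star_mem_opSet {T : E →L[ℂ] E} (hT : T ∈ U.opSet μ) : star T ∈ U.opSet μ := by
  rcases hT with ⟨a, rfl⟩ | ⟨F, rfl⟩
  · exact .inl ⟨-a, (U.star_op a).symm⟩
  · exact .inr ⟨reflect F, (U.star_conv μ F).symm⟩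

lemma opSet_comm {S T : E →L[ℂ] E} (hS : S ∈ U.opSet μ) (hT : T ∈ U.opSet μ) :
    S * T = T * S := by
  rcases hS with ⟨a, rfl⟩ | ⟨F, rfl⟩ <;> rcases hT with ⟨b, rfl⟩ | ⟨F', rfl⟩
  · exact U.op_mul_comm a b
  · exact U.commute_op_conv μ F' a
  · exact (U.commute_op_conv μ F b).symm
  · exact U.mul_conv_of_commute μ _ (fun a => U.commute_op_conv μ F' a) F

/-- The commutative C⋆-algebra generated by the representation and its integrated form. -/
noncomputable def algebra : StarSubalgebra ℂ (E →L[ℂ] E) :=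
  (StarAlgebra.adjoin ℂ (U.opSet μ)).topologicalClosure

lemma subset_algebra {T : E →L[ℂ] E} (hT : T ∈ U.opSet μ) : T ∈ U.algebra μ :=
  StarSubalgebra.le_topologicalClosure _ (StarAlgebra.subset_adjoin ℂ _ hT)

/-- The generators commute with each other and with each other's adjoints, so the algebra they
generate is commutative, and commutativity passes to the closure. -/
lemma algebra_mul_comm (x y : U.algebra μ) : x * y = y * x := by
  have := StarAlgebra.isMulCommutative_adjoin ℂ
    (fun S hS T hT => U.opSet_comm μ hS hT)
    (fun S hS T hT => U.opSet_comm μ hS (U.star_mem_opSet μ hT))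
  exact (StarSubalgebra.commRingTopologicalClosure (StarAlgebra.adjoin ℂ (U.opSet μ))
    (fun x y => mul_comm' x y)).mul_comm x y

noncomputable instance : CommCStarAlgebra (U.algebra μ) :=
  { StarSubalgebra.cstarAlgebra (U.algebra μ)
      (h_closed := StarSubalgebra.isClosed_topologicalClosure _) with
    mul_comm := U.algebra_mul_comm μ }

/-- The norm of the integrated operator of `F` is controlled by the Fourier coefficients of `F`:
characters of the generated commutative C⋆-algebra restrict to frequencies. -/
theorem norm_conv_le_of_fourier (F : C(H, ℂ)) {δ : ℝ}
    (hδ : ∀ ξ : Freq H, ‖∫ a, F a * freqExp ξ a ∂μ‖ ≤ δ) : ‖U.conv μ F‖ ≤ δ := by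
  have hδ0 : 0 ≤ δ := (norm_nonneg _).trans (hδ 0)
  let k : U.algebra μ := ⟨U.conv μ F, U.subset_algebra μ (.inr ⟨F, rfl⟩)⟩
  let u : H → U.algebra μ := fun a => ⟨U.op a, U.subset_algebra μ (.inl ⟨a, rfl⟩)⟩
  -- The Gelfand transform is isometric, so only the values of characters φ at `k` have to be
  -- bounded.
  have hnorm : ‖U.conv μ F‖ = ‖WeakDual.gelfandTransform ℂ (U.algebra μ) k‖ :=
    ((gelfandTransform_isometry (U.algebra μ)).norm_map_of_map_zero (map_zero _) k).symm
  rw [hnorm, ContinuousMap.norm_le _ hδ0]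
  intro φ
  change ‖φ k‖ ≤ δ
  by_cases hk : φ k = 0
  · simpa [hk] using hδ0
  have hcont : Continuous fun a => u a * k :=
    (U.continuous_op_mul_conv μ F).subtype_mk _
  have hφ : Continuous φ := map_continuous φ
  have hu_add : ∀ a b, u (a + b) = u a * u b := fun a b => Subtype.ext (U.op_add a b)
  have hu_star : ∀ a, star (u a) = u (-a) := fun a => Subtype.ext (U.star_op a)
  have hu_zero : u 0 = 1 := Subtype.ext U.op_zero
  -- Dividing by φ(k) ≠ 0 transfers the norm continuity of `u a * k` to a ↦ φ(u a).
  have hcφ : Continuous fun a => φ (u a) := by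
    have : (fun a => φ (u a)) = fun a => φ (u a * k) / φ k := by
      funext a
      rw [map_mul, mul_div_cancel_right₀ _ hk]
    rw [this]
    exact (hφ.comp hcont).div_const _
  have hnormu : ∀ a, ‖φ (u a)‖ = 1 := by
    intro a
    have h1 : φ (u a) * starRingEnd ℂ (φ (u a)) = 1 := by
      have : starRingEnd ℂ (φ (u a)) = φ (star (u a)) := (map_star φ (u a)).symm
      rw [this, hu_star, ← map_mul, ← hu_add, add_neg_cancel, hu_zero, map_one]
    rw [Complex.mul_conj'] at h1
    have h2 : ‖φ (u a)‖ ^ 2 = 1 := by exact_mod_cast h1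
    exact (pow_eq_one_iff_of_nonneg (norm_nonneg _) two_ne_zero).1 h2
  obtain ⟨ξ, hξ⟩ := exists_freqExp_eq (fun a => φ (u a)) hcφ
    (fun a b => by rw [hu_add, map_mul]) hnormu
  have hint : Integrable (fun a => F a • (u a * k)) μ :=
    (F.continuous.smul hcont).integrable_of_compactSpace
  -- The integrand of `k` itself need not be norm continuous, so φ cannot be moved inside directly.
  -- For k² the integrand is norm continuous; the spare factor φ(k) is cancelled at the end.
  have hsq : k * k = ∫ a, F a • (u a * k) ∂μ := by
    let ι : U.algebra μ →L[ℂ] (E →L[ℂ] E) :=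
      ⟨(U.algebra μ).subtype.toAlgHom.toLinearMap, continuous_subtype_val⟩
    have hι : ∀ x : U.algebra μ, ι x = (x : E →L[ℂ] E) := fun x => rfl
    apply Subtype.ext
    rw [← hι, ← hι, ← ContinuousLinearMap.integral_comp_comm ι hint]
    ext p
    rw [ContinuousLinearMap.integral_apply (ι.integrable_comp hint)]
    rfl
  let φL : U.algebra μ →L[ℂ] ℂ := WeakDual.CharacterSpace.toCLM φ
  have hφL : ∀ x, φL x = φ x := fun x => rfl
  have hval : φ k * φ k = (∫ a, F a * freqExp ξ a ∂μ) * φ k := by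
    rw [← map_mul, hsq, ← hφL, ← ContinuousLinearMap.integral_comp_comm φL hint,
      ← integral_mul_const]
    refine integral_congr_ae (.of_forall fun a => ?_)
    simp only [map_smul, hφL, map_mul, smul_eq_mul, hξ, mul_assoc]
  rw [mul_right_cancel₀ hk hval]
  exact hδ ξ

end UnitaryRep
end UnitaryRepresentation

/-! ### The translation representation -/

section Translation

variable {H : Type*} [AddCommGroup H] [TopologicalSpace H] [IsTopologicalAddGroup H]
  [CompactSpace H] [T2Space H] [MeasurableSpace H] [BorelSpace H]
  (μ : Measure H) [IsProbabilityMeasure μ] [μ.IsAddHaarMeasure]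

/-- Translation by `a` on `L²`. -/
noncomputable def translationIsometry (a : H) : Lp ℂ 2 μ →ₗᵢ[ℂ] Lp ℂ 2 μ :=
  Lp.compMeasurePreservingₗᵢ ℂ (fun x => x + a) (measurePreserving_add_right μ a)

lemma translationIsometry_apply (a : H) (p : Lp ℂ 2 μ) :
    translationIsometry μ a p =
      Lp.compMeasurePreserving (fun x => x + a) (measurePreserving_add_right μ a) p := rfl

lemma translationIsometry_zero (p : Lp ℂ 2 μ) : translationIsometry μ 0 p = p := by
  rw [translationIsometry_apply]
  simp only [add_zero]
  exact Lp.compMeasurePreserving_id_apply p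

lemma translationIsometry_add (a b : H) (p : Lp ℂ 2 μ) :
    translationIsometry μ (a + b) p = translationIsometry μ a (translationIsometry μ b p) := by
  simp only [translationIsometry_apply]
  rw [← Lp.compMeasurePreserving_comp_apply]
  have h : ∀ (f g : H → H) (hf : MeasurePreserving f μ μ) (hg : MeasurePreserving g μ μ), f = g →
      Lp.compMeasurePreserving f hf p = Lp.compMeasurePreserving g hg p := by
    rintro f _ hf hg rfl
    rfl
  exact h _ _ _ _ (funext fun x => (add_assoc x a b).symm)

/-- The translation representation of a compact abelian group on `L²`. -/
noncomputable def translationRep : UnitaryRep H (Lp ℂ 2 μ) where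
  op a := (translationIsometry μ a).toContinuousLinearMap
  op_zero := ContinuousLinearMap.ext fun p => translationIsometry_zero μ p
  op_add a b := ContinuousLinearMap.ext fun p => translationIsometry_add μ a b p
  star_op a := by
    rw [ContinuousLinearMap.star_eq_adjoint, eq_comm, ContinuousLinearMap.eq_adjoint_iff]
    intro p q
    change inner ℂ (translationIsometry μ (-a) p) q = inner ℂ p (translationIsometry μ a q)
    rw [← (translationIsometry μ a).inner_map_map, ← translationIsometry_add, add_neg_cancel,
      translationIsometry_zero]
  continuous_op p := by
    let g : C(H, C(H, H)) := ContinuousMap.curry ⟨fun x : H × H => x.2 + x.1, by fun_prop⟩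
    exact Continuous.compMeasurePreservingLp (f := fun _ : H => p) continuous_const g.continuous
      (fun a => measurePreserving_add_right μ a) (by simp)

lemma translationRep_toLp (p : C(H, ℂ)) (a : H) :
    (translationRep μ).op a (ContinuousMap.toLp 2 μ ℂ p) =
      ContinuousMap.toLp 2 μ ℂ ⟨fun x => p (x + a), by fun_prop⟩ := by
  change translationIsometry μ a _ = _
  rw [translationIsometry_apply]
  apply Lp.ext
  refine (Lp.coeFn_compMeasurePreserving _ (measurePreserving_add_right μ a)).trans ?_
  refine Filter.EventuallyEq.trans ?_ (ContinuousMap.coeFn_toLp μ _).symm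
  exact (measurePreserving_add_right μ a).quasiMeasurePreserving.ae_eq_comp
    (ContinuousMap.coeFn_toLp μ p)

/-- Continuous functions on compact spaces can be integrated in either order with no countability
assumption on the spaces. -/
lemma integral_integral_swap_of_continuous {X Y : Type*} [TopologicalSpace X] [CompactSpace X]
    [MeasurableSpace X] [BorelSpace X] [TopologicalSpace Y] [CompactSpace Y]
    [MeasurableSpace Y] [BorelSpace Y] {E : Type*} [NormedAddCommGroup E] [NormedSpace ℝ E]
    {μ : Measure X} [IsFiniteMeasure μ] {ν : Measure Y} [IsFiniteMeasure ν] {f : X → Y → E}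
    (hf : Continuous f.uncurry) : ∫ x, ∫ y, f x y ∂ν ∂μ = ∫ y, ∫ x, f x y ∂μ ∂ν :=
  integral_integral_swap_of_hasCompactSupport hf (HasCompactSupport.of_compactSpace _)

lemma norm_toLp_le (p : C(H, ℂ)) {P : ℝ} (hp : ∀ x, ‖p x‖ ≤ P) :
    ‖ContinuousMap.toLp 2 μ ℂ p‖ ≤ P := by
  have hP : 0 ≤ P := (norm_nonneg _).trans (hp 0)
  have := Lp.norm_le_of_ae_bound (μ := μ) (p := 2) (f := ContinuousMap.toLp 2 μ ℂ p) hP (by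
    filter_upwards [ContinuousMap.coeFn_toLp (p := 2) (𝕜 := ℂ) μ p] with x hx
    rw [hx]
    exact hp x)
  simpa [measureUnivNNReal] using this

/-- A bilinear form with kernel `F (x + y)` is bounded by the Fourier coefficients of `F`. -/
theorem norm_integral_kernel_le {F p q : H → ℂ} (hF : Continuous F) (hp : Continuous p)
    (hq : Continuous q) {δ P Q : ℝ} (hδ : ∀ ξ : Freq H, ‖∫ a, F a * freqExp ξ a ∂μ‖ ≤ δ)
    (hpP : ∀ x, ‖p x‖ ≤ P) (hqQ : ∀ x, ‖q x‖ ≤ Q) :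
    ‖∫ y, ∫ x, F (x + y) * p x * q y ∂μ ∂μ‖ ≤ δ * P * Q := by
  have hδ0 : 0 ≤ δ := (norm_nonneg _).trans (hδ 0)
  let U := translationRep μ
  let F' : C(H, ℂ) := ⟨F, hF⟩
  let p' : C(H, ℂ) := ⟨p, hp⟩
  -- The reflection turns the kernel F(x + y) into the convolution kernel F(x - y); the conjugation
  -- cancels the one in the first argument of the inner product.
  let q' : C(H, ℂ) := ⟨fun y => starRingEnd ℂ (q (-y)), by fun_prop⟩
  have key : ∫ y, ∫ x, F (x + y) * p x * q y ∂μ ∂μ =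
      inner ℂ (ContinuousMap.toLp 2 μ ℂ q') (U.conv μ F' (ContinuousMap.toLp 2 μ ℂ p')) := by
    rw [U.conv_apply]
    refine Eq.trans ?_ (integral_inner (𝕜 := ℂ) (U.integrable μ F' _) _)
    simp only [inner_smul_right]
    calc ∫ y, ∫ x, F (x + y) * p x * q y ∂μ ∂μ
        = ∫ y, ∫ x, F (x - y) * p x * q (-y) ∂μ ∂μ := by
          rw [← integral_neg_eq_self]
          simp [sub_eq_add_neg]
      _ = ∫ y, ∫ x, F x * (p (y + x) * q (-y)) ∂μ ∂μ := by
          congr 1; funext y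
          rw [← integral_add_left_eq_self _ y]
          simp [mul_assoc]
      _ = ∫ x, ∫ y, F x * (p (y + x) * q (-y)) ∂μ ∂μ :=
          integral_integral_swap_of_continuous (by fun_prop)
      _ = _ := by
          refine integral_congr_ae (.of_forall fun a => ?_)
          change _ = F a * _
          simp only [integral_const_mul]
          congr 1
          rw [translationRep_toLp, ContinuousMap.inner_toLp]
          simp [p', q']
  rw [key]
  calc _ ≤ ‖ContinuousMap.toLp 2 μ ℂ q'‖ * ‖U.conv μ F' (ContinuousMap.toLp 2 μ ℂ p')‖ :=
        norm_inner_le_norm _ _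
    _ ≤ Q * (δ * P) := by
        gcongr
        · exact (norm_nonneg _).trans (hqQ 0)
        · exact norm_toLp_le μ q' fun x => by simpa [q'] using hqQ (-x)
        · refine (ContinuousLinearMap.le_opNorm _ _).trans ?_
          gcongr
          · exact U.norm_conv_le_of_fourier μ F' hδ
          · exact norm_toLp_le μ p' hpP
    _ = δ * P * Q := by ring

end Translation

/-! ### Fourier coefficients -/

section Fourier

variable {H : Type*} [AddCommGroup H] [TopologicalSpace H] [IsTopologicalAddGroup H]
  [CompactSpace H] [T2Space H] [MeasurableSpace H] [BorelSpace H]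
  (μ : Measure H) [IsProbabilityMeasure μ] [μ.IsAddHaarMeasure]

/-- The Fourier coefficient `∫ F(x) conj(e(ξ(x))) dx`. -/
noncomputable def fourierAt (F : H → ℂ) (ξ : Freq H) : ℂ :=
  ∫ x, F x * starRingEnd ℂ (freqExp ξ x) ∂μ

lemma fourierAt_neg (F : H → ℂ) (ξ : Freq H) :
    fourierAt μ F (-ξ) = ∫ x, F x * freqExp ξ x ∂μ := by
  have : ∀ x, freqExp (-ξ) x = freqExp ξ (-x) := fun x => by
    rw [freqExp, freqExp, map_neg]
    rfl
  simp [fourierAt, this, freqExp_neg]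

lemma fourierAt_sub {F F' : H → ℂ} (hF : Continuous F) (hF' : Continuous F') (ξ : Freq H) :
    fourierAt μ (fun x => F x - F' x) ξ = fourierAt μ F ξ - fourierAt μ F' ξ := by
  simp only [fourierAt, sub_mul]
  exact integral_sub (Continuous.integrable_of_compactSpace (by fun_prop))
    (Continuous.integrable_of_compactSpace (by fun_prop))

lemma freqExp_injective : Function.Injective (freqExp : Freq H → H → ℂ) := by
  intro ξ ξ' h
  ext x
  exact AddCircle.injective_toCircle one_ne_zero (Subtype.ext (congrFun h x))

/-- Orthogonality of characters. -/
lemma fourierAt_freqExp [DecidableEq (Freq H)] (ξ ξ' : Freq H) :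
    fourierAt μ (freqExp ξ) ξ' = if ξ = ξ' then 1 else 0 := by
  have hone : ∀ (ξ : Freq H) x, freqExp ξ x * starRingEnd ℂ (freqExp ξ x) = 1 := fun ξ x => by
    rw [Complex.mul_conj']
    simp
  split_ifs with h
  · subst h
    simp [fourierAt, hone]
  · obtain ⟨a, ha⟩ : ∃ a, freqExp ξ a ≠ freqExp ξ' a := by
      by_contra! hc
      exact h (freqExp_injective (funext hc))
    have hc : freqExp ξ a * starRingEnd ℂ (freqExp ξ' a) ≠ 1 := by
      intro hc
      apply ha
      rw [← mul_one (freqExp ξ a), ← hone ξ' a, mul_left_comm, hc, mul_one]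
    -- Translation by `a` multiplies the integral by a factor other than 1, so it vanishes.
    have hI : fourierAt μ (freqExp ξ) ξ' =
        (freqExp ξ a * starRingEnd ℂ (freqExp ξ' a)) * fourierAt μ (freqExp ξ) ξ' := by
      conv_lhs => rw [fourierAt, ← integral_add_left_eq_self _ a]
      rw [fourierAt, ← integral_const_mul]
      refine integral_congr_ae (.of_forall fun x => ?_)
      simp only [freqExp_add, map_mul]
      ring
    have : (freqExp ξ a * starRingEnd ℂ (freqExp ξ' a) - 1) * fourierAt μ (freqExp ξ) ξ' = 0 := by
      rw [sub_mul, one_mul, ← hI, sub_self]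
    exact (mul_eq_zero.1 this).resolve_left (sub_ne_zero.2 hc)

lemma fourierAt_sum [DecidableEq (Freq H)] (T : Finset (Freq H)) (c : Freq H → ℂ) (ξ : Freq H) :
    fourierAt μ (fun x => ∑ η ∈ T, c η * freqExp η x) ξ = if ξ ∈ T then c ξ else 0 := by
  have h1 : fourierAt μ (fun x => ∑ η ∈ T, c η * freqExp η x) ξ =
      ∑ η ∈ T, c η * fourierAt μ (freqExp η) ξ := by
    simp only [fourierAt, Finset.sum_mul]
    rw [integral_finsetSum _ fun η _ => Continuous.integrable_of_compactSpace (by fun_prop)]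
    simp only [mul_assoc, integral_const_mul]
  rw [h1]
  simp [fourierAt_freqExp]

lemma integral_norm_sq_sum (T : Finset (Freq H)) (c : Freq H → ℂ) :
    ∫ x, ‖∑ η ∈ T, c η * freqExp η x‖ ^ 2 ∂μ = ∑ η ∈ T, ‖c η‖ ^ 2 := by
  classical
  have h : ((∫ x, ‖∑ η ∈ T, c η * freqExp η x‖ ^ 2 ∂μ : ℝ) : ℂ) =
      ∑ ξ ∈ T, starRingEnd ℂ (c ξ) * fourierAt μ (fun x => ∑ η ∈ T, c η * freqExp η x) ξ := by
    rw [← integral_complex_ofReal]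
    simp only [fourierAt, ← integral_const_mul]
    rw [← integral_finsetSum _ fun η _ => Continuous.integrable_of_compactSpace (by fun_prop)]
    refine integral_congr_ae (.of_forall fun x => ?_)
    simp only [Complex.ofReal_pow]
    rw [← Complex.mul_conj', map_sum, Finset.mul_sum]
    refine Finset.sum_congr rfl fun ξ _ => ?_
    rw [map_mul]
    ring
  have h2 : ((∫ x, ‖∑ η ∈ T, c η * freqExp η x‖ ^ 2 ∂μ : ℝ) : ℂ) =
      ((∑ η ∈ T, ‖c η‖ ^ 2 : ℝ) : ℂ) := by
    rw [h]
    push_cast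
    refine Finset.sum_congr rfl fun ξ hξ => ?_
    rw [fourierAt_sum, if_pos hξ, Complex.conj_mul']
  exact_mod_cast h2

/-- Bessel's inequality. -/
lemma sum_norm_fourierAt_sq_le {F : H → ℂ} (hF : Continuous F) (h1 : ∀ x, ‖F x‖ ≤ 1)
    (T : Finset (Freq H)) : ∑ ξ ∈ T, ‖fourierAt μ F ξ‖ ^ 2 ≤ 1 := by
  classical
  let F' : C(H, ℂ) := ⟨F, hF⟩
  let v : Freq H → Lp ℂ 2 μ := fun ξ =>
    ContinuousMap.toLp 2 μ ℂ ⟨freqExp ξ, continuous_freqExp ξ⟩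
  have hv : Orthonormal ℂ v := by
    rw [orthonormal_iff_ite]
    intro ξ ξ'
    rw [ContinuousMap.inner_toLp]
    exact (fourierAt_freqExp μ ξ' ξ).trans (by simp [eq_comm])
  have hin : ∀ ξ, inner ℂ (v ξ) (ContinuousMap.toLp 2 μ ℂ F') = fourierAt μ F ξ := fun ξ => by
    rw [ContinuousMap.inner_toLp]
    rfl
  have := hv.sum_inner_products_le (ContinuousMap.toLp 2 μ ℂ F') (s := T)
  simp only [hin] at this
  refine this.trans ?_
  have h2 := norm_toLp_le μ F' h1
  exact pow_le_one₀ (norm_nonneg _) h2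

/-- Cauchy–Schwarz on a probability space, through the pointwise inequality t ≤ t²/(2s) + s/2. -/
lemma integral_norm_le_of_sq {F : H → ℂ} (hF : Continuous F) {s : ℝ} (hs : 0 < s)
    (h : ∫ x, ‖F x‖ ^ 2 ∂μ ≤ s ^ 2) : ∫ x, ‖F x‖ ∂μ ≤ s := by
  have h1 : ∫ x, ‖F x‖ ∂μ ≤ ∫ x, ((2 * s)⁻¹ * ‖F x‖ ^ 2 + s / 2) ∂μ := by
    refine integral_mono (Continuous.integrable_of_compactSpace (by fun_prop))
      (Continuous.integrable_of_compactSpace (by fun_prop)) fun x => ?_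
    have : (2 * s)⁻¹ * ‖F x‖ ^ 2 + s / 2 - ‖F x‖ = (2 * s)⁻¹ * (‖F x‖ - s) ^ 2 := by
      field_simp
      ring
    have h0 : 0 ≤ (2 * s)⁻¹ * (‖F x‖ - s) ^ 2 := by positivity
    simp only
    linarith
  rw [integral_add (Continuous.integrable_of_compactSpace (by fun_prop))
    (Continuous.integrable_of_compactSpace (by fun_prop)), integral_const_mul] at h1
  have h2 : (2 * s)⁻¹ * ∫ x, ‖F x‖ ^ 2 ∂μ ≤ (2 * s)⁻¹ * s ^ 2 := by gcongr
  have h3 : (2 * s)⁻¹ * s ^ 2 = s / 2 := by field_simp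
  simp only [integral_const, probReal_univ, one_smul] at h1
  linarith

/-- A continuous function splits into a part that is small in `L¹` and a part with small Fourier
coefficients. -/
lemma exists_add_of_fourierAt {g : H → ℂ} (hg : Continuous g) (T : Finset (Freq H)) {s δ : ℝ}
    (hs : 0 < s) (hδ : 0 ≤ δ) (hT : ∑ ξ ∈ T, ‖fourierAt μ g ξ‖ ^ 2 ≤ s ^ 2)
    (hT' : ∀ ξ ∉ T, ‖fourierAt μ g ξ‖ ≤ δ) :
    ∃ E W : H → ℂ, Continuous E ∧ Continuous W ∧ (∀ x, g x = E x + W x) ∧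
      ∫ x, ‖E x‖ ∂μ ≤ s ∧ ∀ ξ, ‖fourierAt μ W ξ‖ ≤ δ := by
  classical
  have hE : Continuous fun x => ∑ η ∈ T, fourierAt μ g η * freqExp η x := by fun_prop
  -- E is the part of the Fourier expansion of g over T, bounded in L² and hence in L¹; W = g - E
  -- has no coefficients left on T and agrees with g elsewhere.
  refine ⟨fun x => ∑ η ∈ T, fourierAt μ g η * freqExp η x,
    fun x => g x - ∑ η ∈ T, fourierAt μ g η * freqExp η x, hE, by fun_prop, by simp, ?_, ?_⟩
  · refine integral_norm_le_of_sq μ hE hs ?_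
    rwa [integral_norm_sq_sum]
  · intro ξ
    rw [fourierAt_sub μ hg hE, fourierAt_sum]
    split_ifs with h
    · simpa using hδ
    · simpa using hT' ξ h

/-- Only boundedly many Fourier coefficients are large. -/
lemma exists_largeSpectrum {F : H → ℂ} (hF : Continuous F) (h1 : ∀ x, ‖F x‖ ≤ 1) {δ : ℝ}
    (hδ : 0 < δ) : ∃ T : Finset (Freq H), (T.card : ℝ) ≤ (δ ^ 2)⁻¹ ∧
      ∀ ξ, ξ ∈ T ↔ δ ≤ ‖fourierAt μ F ξ‖ := by
  have hcard : ∀ T : Finset (Freq H), (∀ ξ ∈ T, δ ≤ ‖fourierAt μ F ξ‖) →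
      (T.card : ℝ) ≤ (δ ^ 2)⁻¹ := by
    intro T hT
    rw [← one_div, le_div_iff₀ (by positivity)]
    calc (T.card : ℝ) * δ ^ 2 = ∑ ξ ∈ T, δ ^ 2 := by simp
      _ ≤ ∑ ξ ∈ T, ‖fourierAt μ F ξ‖ ^ 2 := by
          refine Finset.sum_le_sum fun ξ hξ => ?_
          have := hT ξ hξ
          gcongr
      _ ≤ 1 := sum_norm_fourierAt_sq_le μ hF h1 T
  -- A uniform bound on the size of all finite subsets makes the whole set finite.
  have hfin : {ξ : Freq H | δ ≤ ‖fourierAt μ F ξ‖}.Finite := by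
    by_contra hinf
    obtain ⟨n, hn⟩ := exists_nat_gt (δ ^ 2)⁻¹
    obtain ⟨T, hT, hTn⟩ := Set.Infinite.exists_subset_card_eq hinf n
    have := hcard T fun ξ hξ => hT hξ
    rw [hTn] at this
    linarith
  exact ⟨hfin.toFinset, hcard _ fun ξ hξ => by simpa using hξ, fun ξ => by simp⟩

/-- Composing with a surjective endomorphism does not create new large Fourier coefficients. -/
lemma norm_integral_comp_surjective_le {U : H → ℂ} (hU : Continuous U) {δ : ℝ}
    (hδ : ∀ ξ : Freq H, ‖∫ a, U a * freqExp ξ a ∂μ‖ ≤ δ) (θ : H →+ H) (hθ : Continuous θ)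
    (hsurj : Function.Surjective θ) (ξ : Freq H) : ‖∫ a, U (θ a) * freqExp ξ a ∂μ‖ ≤ δ := by
  have hδ0 : 0 ≤ δ := (norm_nonneg _).trans (hδ 0)
  -- If ξ is trivial on ker θ, it factors as η ∘ θ and the integral is a Fourier coefficient of U.
  -- Otherwise translating by an element of the kernel shows that the integral is 0.
  by_cases hker : ∀ k, θ k = 0 → ξ k = 0
  · have hwd : ∀ a b, θ a = θ b → ξ a = ξ b := fun a b hab => by
      have := hker (a - b) (by rw [map_sub, hab, sub_self])
      rwa [map_sub, sub_eq_zero] at this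
    let r := Function.surjInv hsurj
    have hr : ∀ y, θ (r y) = y := Function.surjInv_eq hsurj
    let η₀ : H →+ UnitAddCircle := AddMonoidHom.mk' (fun y => ξ (r y)) fun a b => by
      rw [← map_add]
      exact hwd _ _ (by rw [map_add, hr, hr, hr])
    have hηθ : ∀ a, η₀ (θ a) = ξ a := fun a => hwd _ _ (hr _)
    have hη : Continuous η₀ := by
      -- A continuous surjection between compact Hausdorff spaces is a quotient map, so η inherits
      -- continuity from ξ.
      have hq : Topology.IsQuotientMap θ := hθ.isClosedMap.isQuotientMap hθ hsurj
      rw [hq.continuous_iff]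
      exact (map_continuous ξ).congr fun a => (hηθ a).symm
    let η : Freq H := ⟨η₀, hη⟩
    have hexp : ∀ a, freqExp ξ a = freqExp η (θ a) := fun a => by
      change _ = ((AddCircle.toCircle (η₀ (θ a)) : Circle) : ℂ)
      rw [hηθ]
      rfl
    have hmp : MeasurePreserving θ μ μ := θ.measurePreserving hθ hsurj rfl
    have : ∫ a, U (θ a) * freqExp ξ a ∂μ = ∫ a, U a * freqExp η a ∂μ := by
      simp only [hexp]
      conv_rhs => rw [← hmp.map_eq]
      rw [integral_map hmp.measurable.aemeasurable
        (Continuous.integrable_of_compactSpace (by fun_prop)).aestronglyMeasurable]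
    rw [this]
    exact hδ η
  · push Not at hker
    obtain ⟨k, hk, hξk⟩ := hker
    have hne : freqExp ξ k ≠ 1 := by
      intro h
      apply hξk
      apply AddCircle.injective_toCircle one_ne_zero
      rw [AddCircle.toCircle_zero]
      exact Subtype.ext h
    have hI : ∫ a, U (θ a) * freqExp ξ a ∂μ = freqExp ξ k * ∫ a, U (θ a) * freqExp ξ a ∂μ := by
      conv_lhs => rw [← integral_add_left_eq_self _ k]
      rw [← integral_const_mul]
      refine integral_congr_ae (.of_forall fun x => ?_)
      simp only [freqExp_add, map_add, hk, zero_add]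
      ring
    have : (freqExp ξ k - 1) * ∫ a, U (θ a) * freqExp ξ a ∂μ = 0 := by
      rw [sub_mul, one_mul, ← hI, sub_self]
    rw [(mul_eq_zero.1 this).resolve_left (sub_ne_zero.2 hne)]
    simpa using hδ0

end Fourier

/-! ### The trilinear form -/

section Trilinear

variable {H : Type*} [AddCommGroup H] [TopologicalSpace H] [IsTopologicalAddGroup H]
  [CompactSpace H] [T2Space H] [MeasurableSpace H] [BorelSpace H]
  (μ : Measure H) [IsProbabilityMeasure μ] [μ.IsAddHaarMeasure]

/-- `X` need not be first countable, so dominated convergence is avoided: currying gives a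
continuous map into C(H, E), on which integration is 1-Lipschitz. -/
lemma continuous_integral_of_continuous {X E : Type*} [TopologicalSpace X]
    [NormedAddCommGroup E] [NormedSpace ℝ E] {f : X → H → E} (hf : Continuous f.uncurry) :
    Continuous fun x => ∫ y, f x y ∂μ := by
  let F : C(X, C(H, E)) := ContinuousMap.curry ⟨f.uncurry, hf⟩
  have hI : Continuous fun g : C(H, E) => ∫ y, g y ∂μ := by
    refine (LipschitzWith.of_dist_le_mul (K := 1) fun g g' => ?_).continuous
    rw [dist_eq_norm, ← integral_sub g.continuous.integrable_of_compactSpace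
      g'.continuous.integrable_of_compactSpace, NNReal.coe_one, one_mul, dist_eq_norm]
    refine (norm_integral_le_of_norm_le_const (C := ‖g - g'‖) (.of_forall fun y => ?_)).trans
      (by simp)
    exact (g - g').norm_coe_le_norm y
  exact hI.comp F.continuous

/-- Change of variables in a double integral along a surjective endomorphism. -/
lemma integral_integral_comp_surjective {E : Type*} [NormedAddCommGroup E] [NormedSpace ℝ E]
    {f : H → H → E} (hf : Continuous f.uncurry)
    (A B : H → H → H) (hA : Continuous A.uncurry) (hB : Continuous B.uncurry)
    (hA' : ∀ a b a' b', A (a + a') (b + b') = A a b + A a' b')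
    (hB' : ∀ a b a' b', B (a + a') (b + b') = B a b + B a' b')
    (hsurj : ∀ z w, ∃ a b, A a b = z ∧ B a b = w) :
    ∫ w, ∫ z, f z w ∂μ ∂μ = ∫ b, ∫ a, f (A a b) (B a b) ∂μ ∂μ := by
  -- A surjective continuous endomorphism of the compact group H × H preserves its Haar probability
  -- measure.
  let Ψ : BorelProd H H →+ BorelProd H H := AddMonoidHom.mk'
    (fun p => BorelProd.mk (A p.fst p.snd) (B p.fst p.snd)) fun p q => by
      ext
      · simp [hA']
      · simp [hB']
  have hpair : Continuous fun p : BorelProd H H => (p.fst, p.snd) := by fun_prop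
  have hΨ : Continuous Ψ :=
    BorelProd.continuous_mk (hA.comp hpair) (hB.comp hpair)
  have hΨs : Function.Surjective Ψ := fun p => by
    obtain ⟨a, b, h1, h2⟩ := hsurj p.fst p.snd
    exact ⟨BorelProd.mk a b, BorelProd.ext h1 h2⟩
  let π := BorelProd.measure μ μ
  have hmp : MeasurePreserving Ψ π π := Ψ.measurePreserving hΨ hΨs rfl
  have hF : Continuous fun p : BorelProd H H => f p.fst p.snd := hf.comp hpair
  have hFΨ : Continuous fun p : BorelProd H H => f (Ψ p).fst (Ψ p).snd := hF.comp hΨ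
  have hsm : ∀ {g : BorelProd H H → E}, Continuous g → StronglyMeasurable g := fun hg =>
    hg.stronglyMeasurable_of_hasCompactSupport (HasCompactSupport.of_compactSpace _)
  calc ∫ w, ∫ z, f z w ∂μ ∂μ = ∫ p : BorelProd H H, f p.fst p.snd ∂π :=
        (BorelProd.integral_measure μ μ (hsm hF) hF.integrable_of_compactSpace).symm
    _ = ∫ p : BorelProd H H, f (Ψ p).fst (Ψ p).snd ∂π := by
        conv_lhs => rw [← hmp.map_eq]
        rw [integral_map hmp.measurable.aemeasurable (hsm hF).aestronglyMeasurable]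
    _ = _ := BorelProd.integral_measure μ μ (hsm hFΨ) hFΨ.integrable_of_compactSpace

/-- The autocorrelation-type weight `N ∗ N`. -/
noncomputable def selfConv (N : H → ℝ) (w : H) : ℝ := ∫ r, N r * N (w - r) ∂μ

lemma continuous_selfConv {N : H → ℝ} (hN : Continuous N) : Continuous (selfConv μ N) :=
  continuous_integral_of_continuous μ (by fun_prop)

lemma selfConv_nonneg {N : H → ℝ} (hN : ∀ x, 0 ≤ N x) (w : H) : 0 ≤ selfConv μ N w :=
  integral_nonneg fun _ => mul_nonneg (hN _) (hN _)

lemma integral_selfConv {N : H → ℝ} (hN : Continuous N) (h1 : ∫ x, N x ∂μ = 1) :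
    ∫ w, selfConv μ N w ∂μ = 1 := by
  unfold selfConv
  rw [integral_integral_swap_of_continuous (by fun_prop)]
  simp only [integral_const_mul, integral_sub_right_eq_self, h1, mul_one]

/-- This is why the weight is a convolution square: for fixed r the integrand separates into a
function of u times a function of v. -/
lemma selfConv_add {N : H → ℝ} (u v : H) :
    selfConv μ N (u + v) = ∫ r, N (u - r) * N (v + r) ∂μ := by
  rw [selfConv, ← integral_sub_left_eq_self _ μ u]
  refine integral_congr_ae (.of_forall fun r => ?_)
  simp only
  congr 2
  abel

/-- A trilinear form weighted by `N ∗ N` is controlled by Fourier coefficients. -/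
lemma norm_integral_selfConv_le {U p q : H → ℂ} (hU : Continuous U) (hp : Continuous p)
    (hq : Continuous q) {δ M : ℝ} (hδ : ∀ ξ : Freq H, ‖∫ a, U a * freqExp ξ a ∂μ‖ ≤ δ)
    (hp1 : ∀ x, ‖p x‖ ≤ 1) (hq1 : ∀ x, ‖q x‖ ≤ 1) {N : H → ℝ} (hN : Continuous N)
    (hN0 : ∀ x, 0 ≤ N x) (hNM : ∀ x, N x ≤ M) (θ α β : H →+ H) (hθ : Continuous θ)
    (hα : Continuous α) (hβ : Continuous β) (hsurj : Function.Surjective θ) :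
    ‖∫ b, ∫ a, U (θ (a + b)) * p a * q b * selfConv μ N (α a + β b) ∂μ ∂μ‖ ≤ δ * M ^ 2 := by
  have hM : ∀ x, ‖(N x : ℂ)‖ ≤ M := fun x => by
    rw [Complex.norm_real, Real.norm_of_nonneg (hN0 x)]
    exact hNM x
  have hM0 : 0 ≤ M := (hN0 0).trans (hNM 0)
  have hδ0 : 0 ≤ δ := (norm_nonneg _).trans (hδ 0)
  have hexp : ∀ a b, U (θ (a + b)) * p a * q b * selfConv μ N (α a + β b) =
      ∫ r, U (θ (a + b)) * (p a * N (α a - r)) * (q b * N (β b + r)) ∂μ := fun a b => by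
    rw [selfConv_add, ← integral_complex_ofReal, ← integral_const_mul]
    refine integral_congr_ae (.of_forall fun _ => ?_)
    push_cast
    ring
  have hswap : ∫ b, ∫ a, U (θ (a + b)) * p a * q b * selfConv μ N (α a + β b) ∂μ ∂μ =
      ∫ r, ∫ b, ∫ a, U (θ (a + b)) * (p a * N (α a - r)) * (q b * N (β b + r)) ∂μ ∂μ ∂μ := by
    simp only [hexp]
    have h1 : ∀ b, ∫ a, ∫ r, U (θ (a + b)) * (p a * N (α a - r)) * (q b * N (β b + r)) ∂μ ∂μ =
        ∫ r, ∫ a, U (θ (a + b)) * (p a * N (α a - r)) * (q b * N (β b + r)) ∂μ ∂μ := fun b =>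
      integral_integral_swap_of_continuous (by fun_prop)
    simp only [h1]
    refine integral_integral_swap_of_continuous ?_
    refine continuous_integral_of_continuous μ (X := H × H) (f := fun x a =>
      U (θ (a + x.1)) * (p a * N (α a - x.2)) * (q x.1 * N (β x.1 + x.2))) ?_
    fun_prop
  rw [hswap]
  refine (norm_integral_le_of_norm_le_const (C := δ * M ^ 2) (.of_forall fun r => ?_)).trans
    (by simp)
  -- For fixed r the two factors of the weight are absorbed into p and q, at the cost of a factor M
  -- each.
  have := norm_integral_kernel_le μ (F := fun x => U (θ x)) (p := fun a => p a * N (α a - r))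
    (q := fun b => q b * N (β b + r)) (by fun_prop) (by fun_prop) (by fun_prop)
    (norm_integral_comp_surjective_le μ hU hδ θ hθ hsurj)
    (P := M) (Q := M)
    (fun x => by
      rw [norm_mul]
      exact (mul_le_mul (hp1 x) (hM _) (norm_nonneg _) zero_le_one).trans_eq (one_mul M))
    (fun x => by
      rw [norm_mul]
      exact (mul_le_mul (hq1 x) (hM _) (norm_nonneg _) zero_le_one).trans_eq (one_mul M))
  calc _ ≤ δ * M * M := this
    _ = δ * M ^ 2 := by ring

/-- A trilinear form with one factor small in `L¹`. -/
lemma norm_integral_integral_le_of_shift {E : H → ℂ} (hE : Continuous E) {Φ : H → H → ℂ}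
    {X : H → ℝ} (hX : Continuous X) (hX1 : ∫ w, X w ∂μ = 1) (τ : H → H)
    (hΦ : ∀ z w, ‖Φ z w‖ ≤ ‖E (z + τ w)‖ * X w) :
    ‖∫ w, ∫ z, Φ z w ∂μ ∂μ‖ ≤ ∫ x, ‖E x‖ ∂μ := by
  have hin : ∀ w, ‖∫ z, Φ z w ∂μ‖ ≤ (∫ x, ‖E x‖ ∂μ) * X w := fun w => by
    refine (norm_integral_le_of_norm_le (g := fun z => ‖E (z + τ w)‖ * X w)
      (Continuous.integrable_of_compactSpace (by fun_prop)) (.of_forall fun z => hΦ z w)).trans ?_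
    rw [integral_mul_const, integral_add_right_eq_self (fun z => ‖E z‖)]
  refine (norm_integral_le_of_norm_le (g := fun w => (∫ x, ‖E x‖ ∂μ) * X w)
      (Continuous.integrable_of_compactSpace (by fun_prop)) (.of_forall hin)).trans ?_
  rw [integral_const_mul, hX1, mul_one]

variable {J : H →+ H} (hJ : Continuous J) (hJJ : ∀ x, J (J x) = -x)
  (h2 : Function.Surjective fun x : H => (2 : ℕ) • x)

include hJJ h2 in
-- (1 + J)(1 - J) = 1 - J² = 2, so 2-divisibility supplies the preimage.
lemma surjective_id_add : Function.Surjective (AddMonoidHom.id H + J) := fun y => by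
  obtain ⟨x, rfl⟩ := h2 y
  refine ⟨x - J x, ?_⟩
  simp only [AddMonoidHom.add_apply, AddMonoidHom.id_apply, map_sub, hJJ, two_nsmul]
  abel

include hJJ h2 in
lemma surjective_id_sub : Function.Surjective (AddMonoidHom.id H - J) := fun y => by
  obtain ⟨x, rfl⟩ := h2 y
  refine ⟨x + J x, ?_⟩
  simp only [AddMonoidHom.sub_apply, AddMonoidHom.id_apply, map_add, hJJ, two_nsmul]
  abel

/-! ### Fourier control of each slot of the trilinear form -/

section Slots

variable {U p q : H → ℂ} (hU : Continuous U) (hp : Continuous p)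
    (hq : Continuous q) {δ M : ℝ} (hδ : ∀ ξ : Freq H, ‖∫ a, U a * freqExp ξ a ∂μ‖ ≤ δ)
    (hp1 : ∀ x, ‖p x‖ ≤ 1) (hq1 : ∀ x, ‖q x‖ ≤ 1) {N : H → ℝ} (hN : Continuous N)
    (hN0 : ∀ x, 0 ≤ N x) (hNM : ∀ x, N x ≤ M)

include hJ hJJ h2 hU hp hq hδ hp1 hq1 hN hN0 hNM

/-- Substitute z = a + b, w = Ja - b. Then z + w = (1 + J)a involves only a and z + Jw = (1 - J)b
only b. -/
lemma norm_trilinear_left_le :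
    ‖∫ w, ∫ z, U z * p (z + w) * q (z + J w) * selfConv μ N w ∂μ ∂μ‖ ≤ δ * M ^ 2 := by
  have hX := continuous_selfConv μ hN
  rw [integral_integral_comp_surjective μ
    (f := fun z w => U z * p (z + w) * q (z + J w) * selfConv μ N w) (by fun_prop)
    (fun a b => a + b) (fun a b => J a - b) (by fun_prop) (by fun_prop)
    (fun _ _ _ _ => by abel) (fun _ _ _ _ => by rw [map_add]; abel)
    (fun z w => by
      obtain ⟨a, ha⟩ := surjective_id_add hJJ h2 (z + w)
      refine ⟨a, z - a, by abel, ?_⟩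
      simp only [AddMonoidHom.add_apply, AddMonoidHom.id_apply] at ha
      calc J a - (z - a) = (a + J a) - z := by abel
        _ = w := by rw [ha]; abel)]
  have := norm_integral_selfConv_le μ hU (p := fun a => p (a + J a)) (q := fun b => q (b - J b))
    (by fun_prop) (by fun_prop) hδ (fun x => hp1 _) (fun x => hq1 _) hN hN0 hNM
    (AddMonoidHom.id H) J (-AddMonoidHom.id H) continuous_id hJ continuous_neg
    Function.surjective_id
  refine (congrArg norm (integral_congr_ae (.of_forall fun b =>
    integral_congr_ae (.of_forall fun a => ?_)))).trans_le this
  simp only [AddMonoidHom.neg_apply, AddMonoidHom.id_apply, map_sub, hJJ]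
  have e1 : a + b + (J a - b) = a + J a := by abel
  have e2 : a + b + (-a - J b) = b - J b := by abel
  rw [e1, e2, ← sub_eq_add_neg]

/-- Substitute z = a, w = Ja + (1 + J)b. Then z + w = (1 + J)(a + b), while z + Jw = (J - 1)b no
longer involves a. -/
lemma norm_trilinear_middle_le :
    ‖∫ w, ∫ z, p z * U (z + w) * q (z + J w) * selfConv μ N w ∂μ ∂μ‖ ≤ δ * M ^ 2 := by
  have hX := continuous_selfConv μ hN
  rw [integral_integral_comp_surjective μ
    (f := fun z w => p z * U (z + w) * q (z + J w) * selfConv μ N w) (by fun_prop)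
    (fun a _ => a) (fun a b => J a + (b + J b)) (by fun_prop) (by fun_prop)
    (fun _ _ _ _ => rfl) (fun _ _ _ _ => by simp only [map_add]; abel)
    (fun z w => by
      obtain ⟨b, hb⟩ := surjective_id_add hJJ h2 (w - J z)
      refine ⟨z, b, rfl, ?_⟩
      simp only [AddMonoidHom.add_apply, AddMonoidHom.id_apply] at hb
      rw [hb]
      abel)]
  have := norm_integral_selfConv_le μ hU (p := p) (q := fun b => q (J b - b))
    hp (by fun_prop) hδ hp1 (fun x => hq1 _) hN hN0 hNM
    (AddMonoidHom.id H + J) J (AddMonoidHom.id H + J) (continuous_id.add hJ) hJ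
    (continuous_id.add hJ) (surjective_id_add hJJ h2)
  refine (congrArg norm (integral_congr_ae (.of_forall fun b =>
    integral_congr_ae (.of_forall fun a => ?_)))).trans_le this
  simp only [AddMonoidHom.add_apply, AddMonoidHom.id_apply, map_add, hJJ]
  have e1 : a + (J a + (b + J b)) = a + J a + (b + J b) := by abel
  have e2 : a + (-a + (J b + -b)) = J b - b := by abel
  rw [e1, e2]
  ring

/-- Substitute z = a, w = -a - (1 + J)b. Then z + Jw = (1 - J)(a + b), while z + w = -(1 + J)b no
longer involves a. -/
lemma norm_trilinear_right_le :
    ‖∫ w, ∫ z, p z * q (z + w) * U (z + J w) * selfConv μ N w ∂μ ∂μ‖ ≤ δ * M ^ 2 := by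
  have hX := continuous_selfConv μ hN
  rw [integral_integral_comp_surjective μ
    (f := fun z w => p z * q (z + w) * U (z + J w) * selfConv μ N w) (by fun_prop)
    (fun a _ => a) (fun a b => -a - (b + J b)) (by fun_prop) (by fun_prop)
    (fun _ _ _ _ => rfl) (fun _ _ _ _ => by simp only [map_add]; abel)
    (fun z w => by
      obtain ⟨b, hb⟩ := surjective_id_add hJJ h2 (-w - z)
      refine ⟨z, b, rfl, ?_⟩
      simp only [AddMonoidHom.add_apply, AddMonoidHom.id_apply] at hb
      rw [hb]
      abel)]
  have := norm_integral_selfConv_le μ hU (p := p) (q := fun b => q (-(b + J b)))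
    hp (by fun_prop) hδ hp1 (fun x => hq1 _) hN hN0 hNM
    (AddMonoidHom.id H - J) (-AddMonoidHom.id H) (-(AddMonoidHom.id H + J)) (continuous_id.sub hJ)
    continuous_neg (continuous_id.add hJ).neg (surjective_id_sub hJJ h2)
  refine (congrArg norm (integral_congr_ae (.of_forall fun b =>
    integral_congr_ae (.of_forall fun a => ?_)))).trans_le this
  simp only [AddMonoidHom.add_apply, AddMonoidHom.sub_apply, AddMonoidHom.neg_apply,
    AddMonoidHom.id_apply, map_add, map_sub, map_neg, hJJ]
  have e1 : a + (-a - (b + J b)) = -(b + J b) := by abel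
  have e2 : a + (-J a - (J b + -b)) = a - J a + (b - J b) := by abel
  rw [e1, e2, ← sub_eq_add_neg (-a)]
  ring

end Slots

end Trilinear

/-! ### The counting lemma -/

section Counting

variable {H : Type*} [AddCommGroup H] [TopologicalSpace H] [IsTopologicalAddGroup H]
  [CompactSpace H] [T2Space H] [MeasurableSpace H] [BorelSpace H]
  (μ : Measure H) [IsProbabilityMeasure μ] [μ.IsAddHaarMeasure]

lemma integral_integral_add_of_continuous {E : Type*} [NormedAddCommGroup E] [NormedSpace ℝ E]
    {A B : H → H → E} (hA : Continuous A.uncurry) (hB : Continuous B.uncurry) :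
    ∫ w, ∫ z, (A z w + B z w) ∂μ ∂μ = ∫ w, ∫ z, A z w ∂μ ∂μ + ∫ w, ∫ z, B z w ∂μ ∂μ := by
  have hA' : Continuous (fun w z => A z w).uncurry := hA.comp continuous_swap
  have hB' : Continuous (fun w z => B z w).uncurry := hB.comp continuous_swap
  rw [← integral_add (continuous_integral_of_continuous μ hA').integrable_of_compactSpace
    (continuous_integral_of_continuous μ hB').integrable_of_compactSpace]
  refine integral_congr_ae (.of_forall fun w => ?_)
  exact integral_add (Continuous.integrable_of_compactSpace (hA.comp (Continuous.prodMk_left w)))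
    (Continuous.integrable_of_compactSpace (hB.comp (Continuous.prodMk_left w)))

lemma norm_integral_integral_add_le {A B C : H → H → ℂ} (hA : Continuous A.uncurry)
    (hB : Continuous B.uncurry) (hC : ∀ z w, C z w = A z w + B z w) {a b : ℝ}
    (ha : ‖∫ w, ∫ z, A z w ∂μ ∂μ‖ ≤ a) (hb : ‖∫ w, ∫ z, B z w ∂μ ∂μ‖ ≤ b) :
    ‖∫ w, ∫ z, C z w ∂μ ∂μ‖ ≤ a + b := by
  simp only [hC]
  rw [integral_integral_add_of_continuous μ hA hB]
  exact (norm_add_le _ _).trans (add_le_add ha hb)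

variable {J : H →+ H} (hJ : Continuous J) (hJJ : ∀ x, J (J x) = -x)
  (h2 : Function.Surjective fun x : H => (2 : ℕ) • x)

include hJ hJJ h2 in
/-- Replacing one function at a time in the trilinear form. -/
lemma norm_trilinear_sub_le {f f₁ E W : H → ℂ} (hf : Continuous f) (hf₁ : Continuous f₁)
    (hE : Continuous E) (hW : Continuous W) (hdec : ∀ x, f x = f₁ x + (E x + W x))
    (hfb : ∀ x, ‖f x‖ ≤ 1) (hf₁b : ∀ x, ‖f₁ x‖ ≤ 1) {N : H → ℝ} (hN : Continuous N)
    (hN0 : ∀ x, 0 ≤ N x) (hN1 : ∫ x, N x ∂μ = 1) {s δ M : ℝ} (hNM : ∀ x, N x ≤ M)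
    (hs : ∫ x, ‖E x‖ ∂μ ≤ s) (hδ : ∀ ξ : Freq H, ‖∫ a, W a * freqExp ξ a ∂μ‖ ≤ δ) :
    ‖∫ w, ∫ z, (f z * f (z + w) * f (z + J w) - f₁ z * f₁ (z + w) * f₁ (z + J w)) *
      selfConv μ N w ∂μ ∂μ‖ ≤ 3 * (s + δ * M ^ 2) := by
  have hX := continuous_selfConv μ hN
  have hX0 := selfConv_nonneg μ hN0
  have hX1 := integral_selfConv μ hN hN1
  have hXn : ∀ w, ‖(selfConv μ N w : ℂ)‖ = selfConv μ N w := fun w => by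
    rw [Complex.norm_real, Real.norm_of_nonneg (hX0 w)]
  have bound : ∀ a b c x : ℝ, 0 ≤ a → 0 ≤ b → b ≤ 1 → 0 ≤ c → c ≤ 1 → 0 ≤ x →
      a * b * c * x ≤ a * x := fun a b c x ha hb hb1 hc hc1 hx => by
    gcongr
    calc a * b * c ≤ a * 1 * 1 := by gcongr
      _ = a := by ring
  -- In each slot E costs its L¹ norm, the other factors being bounded by 1, and W is handled by
  -- Fourier control.
  have left : ‖∫ w, ∫ z, (E z + W z) * f (z + w) * f (z + J w) * selfConv μ N w ∂μ ∂μ‖ ≤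
      s + δ * M ^ 2 := by
    refine norm_integral_integral_add_le μ
      (A := fun z w => E z * f (z + w) * f (z + J w) * selfConv μ N w)
      (B := fun z w => W z * f (z + w) * f (z + J w) * selfConv μ N w) (by fun_prop) (by fun_prop)
      (fun z w => by ring) (le_trans ?_ hs)
      (norm_trilinear_left_le μ hJ hJJ h2 hW hf hf hδ hfb hfb hN hN0 hNM)
    refine norm_integral_integral_le_of_shift μ hE hX hX1 (fun _ => 0) fun z w => ?_
    simp only [norm_mul, hXn, add_zero]
    exact bound _ _ _ _ (norm_nonneg _) (norm_nonneg _) (hfb _) (norm_nonneg _) (hfb _) (hX0 w)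
  have middle : ‖∫ w, ∫ z, f₁ z * (E (z + w) + W (z + w)) * f (z + J w) *
      selfConv μ N w ∂μ ∂μ‖ ≤ s + δ * M ^ 2 := by
    refine norm_integral_integral_add_le μ
      (A := fun z w => f₁ z * E (z + w) * f (z + J w) * selfConv μ N w)
      (B := fun z w => f₁ z * W (z + w) * f (z + J w) * selfConv μ N w) (by fun_prop)
      (by fun_prop) (fun z w => by ring) (le_trans ?_ hs)
      (norm_trilinear_middle_le μ hJ hJJ h2 hW hf₁ hf hδ hf₁b hfb hN hN0 hNM)
    refine norm_integral_integral_le_of_shift μ hE hX hX1 (fun w => w) fun z w => ?_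
    simp only [norm_mul, hXn]
    rw [mul_comm ‖f₁ z‖]
    exact bound _ _ _ _ (norm_nonneg _) (norm_nonneg _) (hf₁b _) (norm_nonneg _) (hfb _) (hX0 w)
  have right : ‖∫ w, ∫ z, f₁ z * f₁ (z + w) * (E (z + J w) + W (z + J w)) *
      selfConv μ N w ∂μ ∂μ‖ ≤ s + δ * M ^ 2 := by
    refine norm_integral_integral_add_le μ
      (A := fun z w => f₁ z * f₁ (z + w) * E (z + J w) * selfConv μ N w)
      (B := fun z w => f₁ z * f₁ (z + w) * W (z + J w) * selfConv μ N w) (by fun_prop)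
      (by fun_prop) (fun z w => by ring) (le_trans ?_ hs)
      (norm_trilinear_right_le μ hJ hJJ h2 hW hf₁ hf₁ hδ hf₁b hf₁b hN hN0 hNM)
    refine norm_integral_integral_le_of_shift μ hE hX hX1 (fun w => J w) fun z w => ?_
    simp only [norm_mul, hXn]
    refine le_trans (le_of_eq (by ring)) (bound ‖E (z + J w)‖ ‖f₁ z‖ ‖f₁ (z + w)‖ _ (norm_nonneg _)
      (norm_nonneg _) (hf₁b _) (norm_nonneg _) (hf₁b _) (hX0 w))
  -- The telescoping identity abc - a₁b₁c₁ = (a - a₁)bc + a₁(b - b₁)c + a₁b₁(c - c₁).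
  have := norm_integral_integral_add_le μ
    (C := fun z w => (f z * f (z + w) * f (z + J w) - f₁ z * f₁ (z + w) * f₁ (z + J w)) *
      selfConv μ N w)
    (A := fun z w => (E z + W z) * f (z + w) * f (z + J w) * selfConv μ N w +
      f₁ z * (E (z + w) + W (z + w)) * f (z + J w) * selfConv μ N w)
    (B := fun z w => f₁ z * f₁ (z + w) * (E (z + J w) + W (z + J w)) * selfConv μ N w)
    (by fun_prop) (by fun_prop)
    (fun z w => by
      rw [hdec z, hdec (z + w), hdec (z + J w)]
      ring)
    (norm_integral_integral_add_le μ
      (A := fun z w => (E z + W z) * f (z + w) * f (z + J w) * selfConv μ N w)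
      (B := fun z w => f₁ z * (E (z + w) + W (z + w)) * f (z + J w) * selfConv μ N w)
      (by fun_prop) (by fun_prop) (fun _ _ => rfl) left middle) right
  linarith

/-- The smoothing `∫ f(z - u) N(u) du`. -/
noncomputable def smoothing (f N : H → ℝ) (z : H) : ℝ := ∫ u, f (z - u) * N u ∂μ

/-! ### Properties of the smoothed function -/

section Smoothing

variable {f N : H → ℝ} (hf : Continuous f) (hN : Continuous N)

include hf hN

lemma continuous_smoothing : Continuous (smoothing μ f N) :=
  continuous_integral_of_continuous μ (by fun_prop)

lemma smoothing_mem_Icc (hf01 : ∀ x, f x ∈ Set.Icc (0 : ℝ) 1) (hN0 : ∀ x, 0 ≤ N x)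
    (hN1 : ∫ x, N x ∂μ = 1) (z : H) : smoothing μ f N z ∈ Set.Icc (0 : ℝ) 1 := by
  refine ⟨integral_nonneg fun u => mul_nonneg (hf01 _).1 (hN0 _), ?_⟩
  rw [← hN1]
  refine integral_mono (Continuous.integrable_of_compactSpace (by fun_prop))
    (Continuous.integrable_of_compactSpace (by fun_prop)) fun u => ?_
  exact mul_le_of_le_one_left (hN0 u) (hf01 _).2

lemma integral_smoothing (hN1 : ∫ x, N x ∂μ = 1) : ∫ z, smoothing μ f N z ∂μ = ∫ z, f z ∂μ := by
  unfold smoothing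
  rw [integral_integral_swap_of_continuous (by fun_prop)]
  simp only [integral_mul_const, integral_sub_right_eq_self, integral_const_mul, hN1, mul_one]

lemma fourierAt_smoothing (ξ : Freq H) :
    fourierAt μ (fun z => (smoothing μ f N z : ℂ)) ξ =
      fourierAt μ (fun z => (f z : ℂ)) ξ * fourierAt μ (fun z => (N z : ℂ)) ξ := by
  simp only [fourierAt, smoothing]
  calc ∫ z, ((∫ u, f (z - u) * N u ∂μ : ℝ) : ℂ) * starRingEnd ℂ (freqExp ξ z) ∂μ
      = ∫ z, ∫ u, (f (z - u) : ℂ) * N u * starRingEnd ℂ (freqExp ξ z) ∂μ ∂μ := by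
        simp only [← integral_complex_ofReal, ← integral_mul_const, Complex.ofReal_mul]
    _ = ∫ u, ∫ z, (f (z - u) : ℂ) * N u * starRingEnd ℂ (freqExp ξ z) ∂μ ∂μ :=
        integral_integral_swap_of_continuous (by fun_prop)
    _ = ∫ u, (∫ z, (f z : ℂ) * starRingEnd ℂ (freqExp ξ z) ∂μ) *
          (N u * starRingEnd ℂ (freqExp ξ u)) ∂μ := by
        refine integral_congr_ae (.of_forall fun u => ?_)
        simp only
        rw [← integral_add_right_eq_self _ u, ← integral_mul_const]
        refine integral_congr_ae (.of_forall fun z => ?_)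
        simp only [add_sub_cancel_right, freqExp_add, map_mul]
        ring
    _ = _ := by rw [integral_const_mul]

/-- The shift can be moved from f to N, so no regularity of f is needed beyond its bound. -/
lemma abs_smoothing_sub_le (hf01 : ∀ x, f x ∈ Set.Icc (0 : ℝ) 1) {σ : ℝ} {v : H}
    (hv : ∀ u, |N (u + v) - N u| ≤ σ) (z : H) :
    |smoothing μ f N (z + v) - smoothing μ f N z| ≤ σ := by
  have h1 : smoothing μ f N (z + v) = ∫ u, f (z - u) * N (u + v) ∂μ := by
    rw [smoothing, ← integral_add_right_eq_self _ v]
    simp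
  rw [h1, smoothing, ← integral_sub (Continuous.integrable_of_compactSpace (by fun_prop))
    (Continuous.integrable_of_compactSpace (by fun_prop)), ← Real.norm_eq_abs]
  refine (norm_integral_le_of_norm_le_const (C := σ) (.of_forall fun u => ?_)).trans (by simp)
  rw [← mul_sub, Real.norm_eq_abs, abs_mul, abs_of_nonneg (hf01 _).1]
  calc f (z - u) * |N (u + v) - N u| ≤ 1 * σ := by
        gcongr
        · exact (hf01 _).2
        · exact hv u
    _ = σ := one_mul σ

end Smoothing

/-- Jensen by the tangent line at the mean m: t³ - 3m²t + 2m³ = (t - m)²(t + 2m) ≥ 0. -/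
lemma pow_integral_le_integral_pow {f : H → ℝ} (hf : Continuous f) (hf0 : ∀ x, 0 ≤ f x) :
    (∫ x, f x ∂μ) ^ 3 ≤ ∫ x, f x ^ 3 ∂μ := by
  set m := ∫ x, f x ∂μ with hm
  have hm0 : 0 ≤ m := integral_nonneg hf0
  have h1 : ∫ x, (3 * m ^ 2 * f x - 2 * m ^ 3) ∂μ ≤ ∫ x, f x ^ 3 ∂μ := by
    refine integral_mono (Continuous.integrable_of_compactSpace (by fun_prop))
      (Continuous.integrable_of_compactSpace (by fun_prop)) fun x => ?_
    have h0 := hf0 x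
    have : 0 ≤ (f x - m) ^ 2 * (f x + 2 * m) := by positivity
    simp only
    nlinarith
  rw [integral_sub (Continuous.integrable_of_compactSpace (by fun_prop))
    (Continuous.integrable_of_compactSpace (by fun_prop)), integral_const_mul, ← hm] at h1
  simp only [integral_const, probReal_univ, one_smul] at h1
  linarith

/-- Wherever X is nonzero, replacing each shifted value by f(z) loses at most σ, so the product is
at least f(z)³ - 2σ; then X integrates to 1 and Jensen applies. -/
lemma trilinear_ge_of_almost_invariant {f X : H → ℝ} (hf : Continuous f)
    (hf01 : ∀ x, f x ∈ Set.Icc (0 : ℝ) 1) (hX : Continuous X) (hX0 : ∀ x, 0 ≤ X x)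
    (hX1 : ∫ x, X x ∂μ = 1) (hJ : Continuous J) {σ : ℝ}
    (hσ : ∀ w, X w ≠ 0 → ∀ z, |f (z + w) - f z| ≤ σ ∧ |f (z + J w) - f z| ≤ σ) :
    (∫ z, f z ∂μ) ^ 3 - 2 * σ ≤ ∫ w, ∫ z, f z * f (z + w) * f (z + J w) * X w ∂μ ∂μ := by
  have hpt : ∀ w z, (f z ^ 3 - 2 * σ) * X w ≤ f z * f (z + w) * f (z + J w) * X w := by
    intro w z
    by_cases hw : X w = 0
    · simp [hw]
    obtain ⟨h1, h2⟩ := hσ w hw z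
    refine mul_le_mul_of_nonneg_right ?_ (hX0 w)
    have a := hf01 z
    have b := hf01 (z + w)
    have c := hf01 (z + J w)
    have hσ0 : 0 ≤ σ := (abs_nonneg _).trans h1
    have h1' := (abs_le.1 h1).1
    have h2' := (abs_le.1 h2).1
    have e1 : f z * f z * (f z - σ) ≤ f z * f z * f (z + J w) :=
      mul_le_mul_of_nonneg_left (by linarith) (mul_nonneg a.1 a.1)
    have e2 : (f z - σ) * (f z * f (z + J w)) ≤ f (z + w) * (f z * f (z + J w)) :=
      mul_le_mul_of_nonneg_right (by linarith) (mul_nonneg a.1 c.1)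
    have e3 : f z * f z * σ ≤ 1 * σ :=
      mul_le_mul_of_nonneg_right (mul_le_one₀ a.2 a.1 a.2) hσ0
    have e4 : f z * f (z + J w) * σ ≤ 1 * σ :=
      mul_le_mul_of_nonneg_right (mul_le_one₀ a.2 c.1 c.2) hσ0
    nlinarith
  calc (∫ z, f z ∂μ) ^ 3 - 2 * σ ≤ (∫ z, f z ^ 3 ∂μ) - 2 * σ := by
        have := pow_integral_le_integral_pow μ hf fun x => (hf01 x).1
        linarith
    _ = ∫ w, ∫ z, (f z ^ 3 - 2 * σ) * X w ∂μ ∂μ := by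
        simp only [integral_mul_const, integral_const_mul, hX1, mul_one]
        rw [integral_sub (Continuous.integrable_of_compactSpace (by fun_prop))
          (Continuous.integrable_of_compactSpace (by fun_prop))]
        simp
    _ ≤ _ := by
        refine integral_mono (Continuous.integrable_of_compactSpace
            (continuous_integral_of_continuous μ (by fun_prop)))
          (Continuous.integrable_of_compactSpace
            (continuous_integral_of_continuous μ (by fun_prop))) fun w => ?_
        exact integral_mono (Continuous.integrable_of_compactSpace (by fun_prop))
          (Continuous.integrable_of_compactSpace (by fun_prop)) (hpt w)

lemma norm_one_sub_fourierAt_le_two {N : H → ℝ} (hN : Continuous N) (hN0 : ∀ x, 0 ≤ N x)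
    (hN1 : ∫ x, N x ∂μ = 1) (ξ : Freq H) : ‖1 - fourierAt μ (fun z => (N z : ℂ)) ξ‖ ≤ 2 := by
  refine (norm_sub_le _ _).trans ?_
  have : ‖fourierAt μ (fun z => (N z : ℂ)) ξ‖ ≤ 1 := by
    rw [← hN1]
    refine norm_integral_le_of_norm_le (Continuous.integrable_of_compactSpace hN)
      (.of_forall fun x => ?_)
    simp [abs_of_nonneg (hN0 x)]
  rw [norm_one]
  linarith

/-- A kernel concentrated where a character is close to `1` has Fourier coefficient close to `1`. -/
lemma norm_one_sub_fourierAt_le {N : H → ℝ} (hN : Continuous N) (hN0 : ∀ x, 0 ≤ N x)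
    (hN1 : ∫ x, N x ∂μ = 1) {ξ : Freq H} {η : ℝ}
    (hη : ∀ x, N x ≠ 0 → ‖freqExp ξ x - 1‖ ≤ η) :
    ‖1 - fourierAt μ (fun z => (N z : ℂ)) ξ‖ ≤ η := by
  have h1 : 1 - fourierAt μ (fun z => (N z : ℂ)) ξ =
      ∫ x, (N x : ℂ) * (1 - starRingEnd ℂ (freqExp ξ x)) ∂μ := by
    simp only [mul_sub, mul_one]
    rw [integral_sub (Continuous.integrable_of_compactSpace (by fun_prop))
      (Continuous.integrable_of_compactSpace (by fun_prop)), integral_complex_ofReal, hN1]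
    simp [fourierAt]
  rw [h1]
  refine (norm_integral_le_of_norm_le (g := fun x => N x * η)
    (Continuous.integrable_of_compactSpace (by fun_prop)) (.of_forall fun x => ?_)).trans_eq ?_
  · rw [norm_mul, Complex.norm_real, Real.norm_of_nonneg (hN0 x)]
    by_cases hx : N x = 0
    · simp [hx]
    refine mul_le_mul_of_nonneg_left ?_ (hN0 x)
    rw [norm_sub_rev, ← map_one (starRingEnd ℂ), ← map_sub, RCLike.norm_conj]
    exact hη x hx
  · rw [integral_mul_const, hN1, one_mul]

include hJ hJJ h2 in
/-- Lower bound for the trilinear form of a continuous function, weighted by `N' ∗ N'`, in terms of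
a coarser smoothing kernel `N`. -/
theorem trilinear_ge_of_fourierAt {f N N' : H → ℝ} (hf : Continuous f)
    (hf01 : ∀ x, f x ∈ Set.Icc (0 : ℝ) 1) (hN : Continuous N) (hN0 : ∀ x, 0 ≤ N x)
    (hN1 : ∫ x, N x ∂μ = 1) (hN' : Continuous N') (hN'0 : ∀ x, 0 ≤ N' x)
    (hN'1 : ∫ x, N' x ∂μ = 1) {M σ s δ : ℝ} (hM : ∀ x, N' x ≤ M)
    (hσ : ∀ w, selfConv μ N' w ≠ 0 → ∀ u, |N (u + w) - N u| ≤ σ ∧ |N (u + J w) - N u| ≤ σ)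
    (hs : 0 < s) (T : Finset (Freq H))
    (hT : ∑ ξ ∈ T, ‖fourierAt μ (fun z => (f z : ℂ)) ξ‖ ^ 2 *
      ‖1 - fourierAt μ (fun z => (N z : ℂ)) ξ‖ ^ 2 ≤ s ^ 2)
    (hT' : ∀ ξ ∉ T, ‖fourierAt μ (fun z => (f z : ℂ)) ξ‖ ≤ δ) (hδ : 0 ≤ δ) :
    (∫ z, f z ∂μ) ^ 3 - 2 * σ - 3 * (s + 2 * δ * M ^ 2) ≤
      ∫ w, ∫ z, f z * f (z + w) * f (z + J w) * selfConv μ N' w ∂μ ∂μ := by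
  set f₁ := smoothing μ f N with hf₁def
  have hf₁ : Continuous f₁ := continuous_smoothing μ hf hN
  have hf₁01 : ∀ z, f₁ z ∈ Set.Icc (0 : ℝ) 1 := smoothing_mem_Icc μ hf hN hf01 hN0 hN1
  have hX := continuous_selfConv μ hN'
  have hghat : ∀ ξ, fourierAt μ (fun z => (f z : ℂ) - (f₁ z : ℂ)) ξ =
      fourierAt μ (fun z => (f z : ℂ)) ξ * (1 - fourierAt μ (fun z => (N z : ℂ)) ξ) := fun ξ => by
    rw [fourierAt_sub μ (by fun_prop) (by fun_prop), hf₁def, fourierAt_smoothing μ hf hN]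
    ring
  -- Outside T the coefficients of f - f₁ are bounded by 2δ, since |1 - N̂| ≤ 2.
  obtain ⟨E, W, hE, hW, hEW, hEs, hWδ⟩ := exists_add_of_fourierAt μ
    (g := fun z => (f z : ℂ) - (f₁ z : ℂ)) (by fun_prop) T hs (δ := 2 * δ) (by positivity)
    (by
      refine le_trans (le_of_eq (Finset.sum_congr rfl fun ξ _ => ?_)) hT
      rw [hghat, norm_mul, mul_pow])
    (fun ξ hξ => by
      rw [hghat, norm_mul]
      have h1 := hT' ξ hξ
      have h2 := norm_one_sub_fourierAt_le_two μ hN hN0 hN1 ξ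
      calc _ ≤ δ * 2 := by gcongr
        _ = 2 * δ := mul_comm _ _)
  have norm_le : ∀ t : ℝ, t ∈ Set.Icc (0 : ℝ) 1 → ‖(t : ℂ)‖ ≤ 1 := fun t ht => by
    rw [Complex.norm_real, Real.norm_of_nonneg ht.1]
    exact ht.2
  have hdiff := norm_trilinear_sub_le μ hJ hJJ h2 (f := fun z => (f z : ℂ))
    (f₁ := fun z => (f₁ z : ℂ)) (by fun_prop) (by fun_prop) hE hW
    (fun x => by rw [← hEW]; ring) (fun x => norm_le _ (hf01 x)) (fun x => norm_le _ (hf₁01 x))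
    hN' hN'0 hN'1 hM hEs (fun ξ => by rw [← fourierAt_neg]; exact hWδ _)
  have hreal : ∫ w, ∫ z, ((f z : ℂ) * f (z + w) * f (z + J w) -
      (f₁ z : ℂ) * f₁ (z + w) * f₁ (z + J w)) * selfConv μ N' w ∂μ ∂μ =
      ((∫ w, ∫ z, (f z * f (z + w) * f (z + J w) * selfConv μ N' w +
        -(f₁ z * f₁ (z + w) * f₁ (z + J w) * selfConv μ N' w)) ∂μ ∂μ : ℝ) : ℂ) := by
    simp only [← integral_complex_ofReal]
    refine integral_congr_ae (.of_forall fun w => integral_congr_ae (.of_forall fun z => ?_))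
    push_cast
    ring
  rw [hreal, Complex.norm_real, integral_integral_add_of_continuous μ
    (A := fun z w => f z * f (z + w) * f (z + J w) * selfConv μ N' w)
    (B := fun z w => -(f₁ z * f₁ (z + w) * f₁ (z + J w) * selfConv μ N' w))
    (by fun_prop) (by fun_prop)] at hdiff
  simp only [integral_neg] at hdiff
  have hmain := trilinear_ge_of_almost_invariant μ hf₁ hf₁01 hX (selfConv_nonneg μ hN'0)
    (integral_selfConv μ hN' hN'1) hJ (σ := σ) fun w hw z =>
      ⟨abs_smoothing_sub_le μ hf hN hf01 (fun u => (hσ w hw u).1) z,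
        abs_smoothing_sub_le μ hf hN hf01 (fun u => (hσ w hw u).2) z⟩
  rw [hf₁def, integral_smoothing μ hf hN hN1, ← hf₁def] at hmain
  have := (abs_le.1 (Real.norm_eq_abs _ ▸ hdiff)).1
  linarith

end Counting

/-! ### Tent functions on Bohr sets -/

section Tent

variable {G : Type*} [AddCommGroup G] [TopologicalSpace G]

lemma freqMax_nonneg (S : Finset (Freq G)) (x : G) : 0 ≤ freqMax S x := NNReal.coe_nonneg _

lemma freqMax_le_iff {S : Finset (Freq G)} {x : G} {r : ℝ} (hr : 0 ≤ r) :
    freqMax S x ≤ r ↔ ∀ ξ ∈ S, ‖ξ x‖ ≤ r := by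
  lift r to ℝ≥0 using hr
  rw [freqMax, NNReal.coe_le_coe, Finset.sup_le_iff]
  rfl

lemma norm_le_freqMax {S : Finset (Freq G)} {ξ : Freq G} (hξ : ξ ∈ S) (x : G) :
    ‖ξ x‖ ≤ freqMax S x :=
  (freqMax_le_iff (freqMax_nonneg S x)).1 le_rfl ξ hξ

lemma freqMax_add_le (S : Finset (Freq G)) (x y : G) :
    freqMax S (x + y) ≤ freqMax S x + freqMax S y := by
  rw [freqMax_le_iff (add_nonneg (freqMax_nonneg S x) (freqMax_nonneg S y))]
  intro ξ hξ
  rw [map_add]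
  exact (norm_add_le _ _).trans (add_le_add (norm_le_freqMax hξ x) (norm_le_freqMax hξ y))

@[simp] lemma freqMax_neg (S : Finset (Freq G)) (x : G) : freqMax S (-x) = freqMax S x := by
  simp [freqMax]

lemma abs_freqMax_add_sub_le (S : Finset (Freq G)) (x v : G) :
    |freqMax S (x + v) - freqMax S x| ≤ freqMax S v := by
  have h1 := freqMax_add_le S x v
  have h2 := freqMax_add_le S (x + v) (-v)
  rw [add_neg_cancel_right, freqMax_neg] at h2
  rw [abs_le]
  constructor <;> linarith

@[fun_prop] lemma continuous_freqMax (S : Finset (Freq G)) : Continuous (freqMax S) := by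
  refine NNReal.continuous_coe.comp ?_
  have : Continuous fun x : G => S.sup fun ξ => ‖ξ x‖₊ := by
    have := Continuous.finset_sup (s := S) (f := fun (ξ : Freq G) (x : G) => ‖ξ x‖₊)
      fun ξ _ => (map_continuous ξ).nnnorm
    refine this.congr fun x => ?_
    rw [Finset.sup_apply]
  exact this

@[fun_prop] lemma continuous_rawTent (S : Finset (Freq G)) (ρ : ℝ) : Continuous (rawTent S ρ) := by
  unfold rawTent
  fun_prop

lemma rawTent_nonneg (S : Finset (Freq G)) (ρ : ℝ) (x : G) : 0 ≤ rawTent S ρ x := le_max_right _ _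

lemma rawTent_le_one (S : Finset (Freq G)) {ρ : ℝ} (hρ : 0 < ρ) (x : G) : rawTent S ρ x ≤ 1 := by
  refine max_le ?_ zero_le_one
  have := freqMax_nonneg S x
  have : 0 ≤ ρ⁻¹ * freqMax S x := by positivity
  linarith

lemma freqMax_lt_of_rawTent_ne_zero {S : Finset (Freq G)} {ρ : ℝ} (hρ : 0 < ρ) {x : G}
    (h : rawTent S ρ x ≠ 0) : freqMax S x < ρ := by
  by_contra! hc
  apply h
  refine max_eq_right ?_
  have : 1 ≤ ρ⁻¹ * freqMax S x := by
    rw [inv_mul_eq_div, one_le_div hρ]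
    exact hc
  linarith

lemma abs_rawTent_add_sub_le (S : Finset (Freq G)) {ρ : ℝ} (hρ : 0 < ρ) (x v : G) :
    |rawTent S ρ (x + v) - rawTent S ρ x| ≤ ρ⁻¹ * freqMax S v := by
  refine (abs_max_sub_max_le_abs _ _ _).trans ?_
  have : 1 - ρ⁻¹ * freqMax S (x + v) - (1 - ρ⁻¹ * freqMax S x) =
    -(ρ⁻¹ * (freqMax S (x + v) - freqMax S x)) := by ring
  rw [this, abs_neg, abs_mul, abs_of_pos (inv_pos.2 hρ)]
  gcongr
  exact abs_freqMax_add_sub_le S x v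

/-- A lower bound for the mass of tent functions with at most `d` frequencies and radius `ρ`. -/
noncomputable def tentMass (d : ℕ) (ρ : ℝ) : ℝ := (2 * (⌈4 / ρ⌉₊ : ℝ) ^ d)⁻¹

lemma tentMass_pos (d : ℕ) {ρ : ℝ} (hρ : 0 < ρ) : 0 < tentMass d ρ := by
  have : 0 < ⌈4 / ρ⌉₊ := Nat.ceil_pos.2 (by positivity)
  unfold tentMass
  positivity

lemma tentMass_le_one (d : ℕ) {ρ : ℝ} (hρ : 0 < ρ) : tentMass d ρ ≤ 1 := by
  have : 0 < ⌈4 / ρ⌉₊ := Nat.ceil_pos.2 (by positivity)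
  refine inv_le_one_of_one_le₀ ?_
  have h1 : (1 : ℝ) ≤ (⌈4 / ρ⌉₊ : ℝ) ^ d := one_le_pow₀ (by exact_mod_cast this)
  linarith

/-- Provides the grid for the pigeonhole bound on the measure of Bohr sets. -/
lemma exists_norm_sub_div_le {K : ℕ} (hK : 0 < K) (t : UnitAddCircle) :
    ∃ j : Fin K, ‖t - (((j : ℝ) / K : ℝ) : UnitAddCircle)‖ ≤ (K : ℝ)⁻¹ := by
  have hK' : (0 : ℝ) < K := by exact_mod_cast hK
  let r := AddCircle.equivIco (1 : ℝ) 0 t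
  have hr : ((r : ℝ) : UnitAddCircle) = t := (AddCircle.equivIco (1 : ℝ) 0).symm_apply_apply t
  have hr0 : 0 ≤ (r : ℝ) := r.2.1
  have hr1 : (r : ℝ) < 1 := by simpa using r.2.2
  have hKr : 0 ≤ (K : ℝ) * r := by positivity
  refine ⟨⟨⌊(K : ℝ) * r⌋₊, ?_⟩, ?_⟩
  · rw [Nat.floor_lt hKr]
    nlinarith
  · rw [← hr, ← AddCircle.coe_sub]
    have h0 : ∀ y : ℝ, ‖(y : UnitAddCircle)‖ ≤ |y| := fun y => by
      simpa [UnitAddCircle.norm_eq] using round_le y 0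
    refine (h0 _).trans ?_
    have h1 := Nat.floor_le hKr
    have h2 := Nat.lt_floor_add_one ((K : ℝ) * r)
    have h3 : (r : ℝ) - (⌊(K : ℝ) * r⌋₊ : ℝ) / K = (K : ℝ)⁻¹ * (K * r - ⌊(K : ℝ) * r⌋₊) := by
      field_simp
    simp only
    rw [h3, abs_mul, abs_of_pos (inv_pos.2 hK'), abs_of_nonneg (by linarith)]
    exact mul_le_of_le_one_right (by positivity) (by linarith)

variable [IsTopologicalAddGroup G] [CompactSpace G] [MeasurableSpace G] [BorelSpace G]
  (μ : Measure G) [IsProbabilityMeasure μ] [μ.IsAddHaarMeasure]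

/-- Bohr sets have measure bounded below in terms of their rank and radius. -/
lemma one_le_card_pow_mul_measure (S : Finset (Freq G)) {K : ℕ} (hK : 0 < K) :
    1 ≤ (K : ENNReal) ^ S.card * μ {x | freqMax S x ≤ 2 * (K : ℝ)⁻¹} := by
  classical
  choose j hj using exists_norm_sub_div_le hK
  let c : G → (S → Fin K) := fun x ξ => j (ξ.1 x)
  -- Two points of the same cell have frequency values within 2/K of each other, so translating a
  -- cell by one of its points puts it inside the Bohr set.
  have hfib : ∀ k, μ (c ⁻¹' {k}) ≤ μ {x | freqMax S x ≤ 2 * (K : ℝ)⁻¹} := by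
    intro k
    rcases (c ⁻¹' {k}).eq_empty_or_nonempty with h | ⟨x₀, hx₀⟩
    · simp [h]
    rw [← measure_preimage_add_right μ (-x₀) {x | freqMax S x ≤ 2 * (K : ℝ)⁻¹}]
    refine measure_mono fun x hx => ?_
    simp only [Set.mem_preimage, Set.mem_ofPred_eq]
    rw [freqMax_le_iff (by positivity)]
    intro ξ hξ
    have h1 : j (ξ x) = k ⟨ξ, hξ⟩ := congrFun hx ⟨ξ, hξ⟩
    have h2 : j (ξ x₀) = k ⟨ξ, hξ⟩ := congrFun hx₀ ⟨ξ, hξ⟩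
    have h3 := hj (ξ x)
    have h4 := hj (ξ x₀)
    rw [h1] at h3
    rw [h2] at h4
    rw [map_add, map_neg, ← sub_eq_add_neg]
    have h5 := norm_sub_le_norm_sub_add_norm_sub (ξ x)
      (((k ⟨ξ, hξ⟩ : ℕ) / K : ℝ) : UnitAddCircle) (ξ x₀)
    rw [norm_sub_rev (((k ⟨ξ, hξ⟩ : ℕ) / K : ℝ) : UnitAddCircle) (ξ x₀)] at h5
    linarith
  -- The cells come from an arbitrary choice and need not be measurable; subadditivity suffices.
  calc (1 : ENNReal) = μ (⋃ k, c ⁻¹' {k}) := by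
        rw [← Set.preimage_iUnion, Set.iUnion_of_singleton, Set.preimage_univ, measure_univ]
    _ ≤ ∑ k, μ (c ⁻¹' {k}) := measure_iUnion_fintype_le _ _
    _ ≤ ∑ _k : S → Fin K, μ {x | freqMax S x ≤ 2 * (K : ℝ)⁻¹} := Finset.sum_le_sum fun k _ => hfib k
    _ = _ := by simp

lemma tentMass_le_integral {S : Finset (Freq G)} {d : ℕ} (hS : S.card ≤ d) {ρ : ℝ} (hρ : 0 < ρ) :
    tentMass d ρ ≤ ∫ x, rawTent S ρ x ∂μ := by
  -- With this K the Bohr set of radius 2/K lies where freqMax ≤ ρ/2, so that the tent is at least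
  -- 1/2 on it; this is the factor 2 in `tentMass`.
  set K := ⌈4 / ρ⌉₊ with hKdef
  have hK : 0 < K := Nat.ceil_pos.2 (by positivity)
  have hK' : (0 : ℝ) < K := by exact_mod_cast hK
  have hKρ : 2 * (K : ℝ)⁻¹ ≤ ρ / 2 := by
    have : 4 / ρ ≤ K := Nat.le_ceil _
    rw [div_le_iff₀ hρ] at this
    rw [← div_eq_mul_inv, div_le_iff₀ hK']
    linarith
  set B : Set G := {x | freqMax S x ≤ 2 * (K : ℝ)⁻¹} with hB
  have hBm : MeasurableSet B := (isClosed_le (continuous_freqMax S) continuous_const).measurableSet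
  have h1 : (1 : ℝ) ≤ K ^ S.card * μ.real B := by
    have := ENNReal.toReal_mono (by finiteness) (one_le_card_pow_mul_measure μ S hK)
    simpa [Measure.real] using this
  have h2 : 1 / 2 * μ.real B ≤ ∫ x, rawTent S ρ x ∂μ := by
    have : ∫ x, B.indicator (fun _ => (1 / 2 : ℝ)) x ∂μ ≤ ∫ x, rawTent S ρ x ∂μ := by
      refine integral_mono ((integrable_const _).indicator hBm)
        (Continuous.integrable_of_compactSpace (by fun_prop)) fun x => ?_
      by_cases hx : x ∈ B
      · rw [Set.indicator_of_mem hx]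
        refine le_max_of_le_left ?_
        have h3 : freqMax S x ≤ ρ / 2 := le_trans hx hKρ
        have h4 : ρ⁻¹ * freqMax S x ≤ ρ⁻¹ * (ρ / 2) := by gcongr
        have h5 : ρ⁻¹ * (ρ / 2) = 1 / 2 := by field_simp
        linarith
      · rw [Set.indicator_of_notMem hx]
        exact rawTent_nonneg S ρ x
    rw [integral_indicator_const _ hBm] at this
    simpa [mul_comm] using this
  refine le_trans ?_ h2
  have h3 : (K : ℝ) ^ S.card ≤ (K : ℝ) ^ d := pow_le_pow_right₀ (by exact_mod_cast hK) hS
  have h4 : (1 : ℝ) ≤ K ^ d * μ.real B := h1.trans (by gcongr)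
  rw [tentMass, mul_inv, ← hKdef]
  have h5 : ((K : ℝ) ^ d)⁻¹ ≤ μ.real B := by
    rw [inv_le_iff_one_le_mul₀ (by positivity)]
    linarith
  linarith

lemma tent_eq (S : Finset (Freq G)) (ρ : ℝ) (x : G) :
    tent μ S ρ x = (∫ y, rawTent S ρ y ∂μ)⁻¹ * rawTent S ρ x := by
  simp [tent, abs_of_nonneg (rawTent_nonneg S ρ _)]

@[fun_prop] lemma continuous_tent (S : Finset (Freq G)) (ρ : ℝ) : Continuous (tent μ S ρ) := by
  unfold tent
  fun_prop

lemma tent_nonneg (S : Finset (Freq G)) (ρ : ℝ) (x : G) : 0 ≤ tent μ S ρ x := by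
  rw [tent_eq]
  exact mul_nonneg (inv_nonneg.2 (integral_nonneg fun y => rawTent_nonneg S ρ y))
    (rawTent_nonneg S ρ x)

lemma integral_rawTent_pos (S : Finset (Freq G)) {ρ : ℝ} (hρ : 0 < ρ) :
    0 < ∫ x, rawTent S ρ x ∂μ :=
  (tentMass_pos S.card hρ).trans_le (tentMass_le_integral μ le_rfl hρ)

lemma integral_tent (S : Finset (Freq G)) {ρ : ℝ} (hρ : 0 < ρ) : ∫ x, tent μ S ρ x ∂μ = 1 := by
  simp only [tent_eq, integral_const_mul]
  exact inv_mul_cancel₀ (integral_rawTent_pos μ S hρ).ne'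

lemma freqMax_lt_of_tent_ne_zero {S : Finset (Freq G)} {ρ : ℝ} (hρ : 0 < ρ) {x : G}
    (h : tent μ S ρ x ≠ 0) : freqMax S x < ρ :=
  freqMax_lt_of_rawTent_ne_zero hρ (right_ne_zero_of_mul h)

lemma tent_le {S : Finset (Freq G)} {d : ℕ} (hS : S.card ≤ d) {ρ : ℝ} (hρ : 0 < ρ) (x : G) :
    tent μ S ρ x ≤ (tentMass d ρ)⁻¹ := by
  rw [tent_eq]
  have h1 := tentMass_le_integral μ hS hρ
  have h2 := tentMass_pos d hρ
  calc _ ≤ (tentMass d ρ)⁻¹ * 1 := by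
        gcongr
        · exact rawTent_nonneg S ρ x
        · exact rawTent_le_one S hρ x
    _ = _ := mul_one _

lemma abs_tent_add_sub_le {S : Finset (Freq G)} {d : ℕ} (hS : S.card ≤ d) {ρ : ℝ} (hρ : 0 < ρ)
    (x v : G) :
    |tent μ S ρ (x + v) - tent μ S ρ x| ≤ (tentMass d ρ)⁻¹ * (ρ⁻¹ * freqMax S v) := by
  rw [tent_eq, tent_eq, ← mul_sub, abs_mul, abs_of_pos (inv_pos.2 (integral_rawTent_pos μ S hρ))]
  have h1 := tentMass_le_integral μ hS hρ
  have h2 := tentMass_pos d hρ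
  gcongr
  exact abs_rawTent_add_sub_le S hρ x v

lemma weight_eq_selfConv (S : Finset (Freq G)) (ρ : ℝ) :
    weight μ S ρ = selfConv μ (tent μ S ρ) := rfl

/-- The two summands are kept apart: on ℤ/Nℤ each is rounded separately, which gives the support
bound 2⌊ρN⌋ and not just ⌊2ρN⌋. -/
lemma exists_of_weight_ne_zero {S : Finset (Freq G)} {ρ : ℝ} (hρ : 0 < ρ) {x : G}
    (h : weight μ S ρ x ≠ 0) : ∃ y z, x = y + z ∧ freqMax S y < ρ ∧ freqMax S z < ρ := by
  by_contra! hc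
  apply h
  rw [weight_eq_selfConv, selfConv]
  refine integral_eq_zero_of_ae (.of_forall fun r => ?_)
  by_contra hne
  have h1 := freqMax_lt_of_tent_ne_zero μ hρ (left_ne_zero_of_mul hne)
  have h2 := freqMax_lt_of_tent_ne_zero μ hρ (right_ne_zero_of_mul hne)
  exact absurd h2 (not_lt.2 (hc r (x - r) (by abel) h1))

lemma freqMax_lt_of_weight_ne_zero {S : Finset (Freq G)} {ρ : ℝ} (hρ : 0 < ρ) {x : G}
    (h : weight μ S ρ x ≠ 0) : freqMax S x < 2 * ρ := by
  obtain ⟨y, z, rfl, hy, hz⟩ := exists_of_weight_ne_zero μ hρ h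
  linarith [freqMax_add_le S y z]

end Tent

lemma norm_toCircle_sub_one_le (t : UnitAddCircle) :
    ‖((AddCircle.toCircle t : Circle) : ℂ) - 1‖ ≤ 2 * Real.pi * ‖t‖ := by
  obtain ⟨y, rfl⟩ := QuotientAddGroup.mk_surjective t
  change ‖((AddCircle.toCircle (y : UnitAddCircle) : Circle) : ℂ) - 1‖ ≤
    2 * Real.pi * ‖(y : UnitAddCircle)‖
  -- The representative nearest to 0 is used, and the chord is at most the arc.
  have hy : (y : UnitAddCircle) = ((y - round y : ℝ) : UnitAddCircle) := by
    rw [AddCircle.coe_sub]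
    have : ((round y : ℝ) : UnitAddCircle) = 0 :=
      (AddCircle.coe_eq_zero_iff 1).2 ⟨round y, by simp⟩
    rw [this, sub_zero]
  rw [UnitAddCircle.norm_eq, hy, AddCircle.toCircle_apply_mk, Circle.coe_exp, mul_comm _ Complex.I]
  refine Real.norm_exp_I_mul_ofReal_sub_one_le.trans_eq ?_
  rw [Real.norm_eq_abs, abs_mul, div_one, abs_of_pos (by positivity)]

/-! ### Continuous functions on the square of the group -/

section Square

variable {G : Type*} [AddCommGroup G] [TopologicalSpace G]

/-- Rotation by a right angle on `G × G`. -/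
def quarterTurn (G : Type*) [AddCommGroup G] : BorelProd G G →+ BorelProd G G :=
  AddMonoidHom.mk' (fun p => BorelProd.mk (-p.snd) p.fst) fun p q => by
    ext
    · simp [add_comm]
    · simp

@[simp] lemma fst_quarterTurn (p : BorelProd G G) : (quarterTurn G p).fst = -p.snd := rfl
@[simp] lemma snd_quarterTurn (p : BorelProd G G) : (quarterTurn G p).snd = p.fst := rfl

lemma quarterTurn_quarterTurn (p : BorelProd G G) : quarterTurn G (quarterTurn G p) = -p := by
  ext <;> simp

lemma continuous_quarterTurn [IsTopologicalAddGroup G] : Continuous (quarterTurn G) := by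
  change Continuous fun p : BorelProd G G => BorelProd.mk (-p.snd) p.fst
  fun_prop

/-- The restriction of a frequency of `G × G` to the first factor. -/
def freqFst (ζ : Freq (BorelProd G G)) : Freq G :=
  ⟨AddMonoidHom.mk' (fun x => ζ (BorelProd.mk x 0)) fun a b => by
    rw [← map_add]
    congr 1
    ext <;> simp, (map_continuous ζ).comp (by fun_prop)⟩

/-- The restriction of a frequency of `G × G` to the second factor. -/
def freqSnd (ζ : Freq (BorelProd G G)) : Freq G :=
  ⟨AddMonoidHom.mk' (fun x => ζ (BorelProd.mk 0 x)) fun a b => by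
    rw [← map_add]
    congr 1
    ext <;> simp, (map_continuous ζ).comp (by fun_prop)⟩

/-- Thus frequencies of G alone, collected in S, control the frequencies of G × G. -/
lemma freq_eq_add (ζ : Freq (BorelProd G G)) (p : BorelProd G G) :
    ζ p = freqFst ζ p.fst + freqSnd ζ p.snd := by
  change ζ p = ζ (BorelProd.mk p.fst 0) + ζ (BorelProd.mk 0 p.snd)
  rw [← map_add]
  congr 1
  ext <;> simp

variable [IsTopologicalAddGroup G] [CompactSpace G] [T2Space G] [MeasurableSpace G] [BorelSpace G]
  (μ : Measure G) [IsProbabilityMeasure μ] [μ.IsAddHaarMeasure]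

/-- The product tent on `G × G`. -/
noncomputable def tentSq (S : Finset (Freq G)) (ρ : ℝ) (p : BorelProd G G) : ℝ :=
  tent μ S ρ p.fst * tent μ S ρ p.snd

lemma integral_borelProd_of_continuous {E : Type*} [NormedAddCommGroup E] [NormedSpace ℝ E]
    {f : BorelProd G G → E} (hf : Continuous f) :
    ∫ p, f p ∂BorelProd.measure μ μ = ∫ y, ∫ x, f (BorelProd.mk x y) ∂μ ∂μ :=
  BorelProd.integral_measure μ μ
    (hf.stronglyMeasurable_of_hasCompactSupport (HasCompactSupport.of_compactSpace _))
    hf.integrable_of_compactSpace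

variable (S : Finset (Freq G)) {ρ : ℝ}

@[fun_prop] lemma continuous_tentSq (ρ : ℝ) : Continuous (tentSq μ S ρ) := by
  unfold tentSq
  fun_prop

lemma tentSq_nonneg (ρ : ℝ) (p : BorelProd G G) : 0 ≤ tentSq μ S ρ p :=
  mul_nonneg (tent_nonneg μ S ρ _) (tent_nonneg μ S ρ _)

lemma integral_tentSq (hρ : 0 < ρ) : ∫ p, tentSq μ S ρ p ∂BorelProd.measure μ μ = 1 := by
  rw [integral_borelProd_of_continuous μ (continuous_tentSq μ S ρ)]
  simp [tentSq, integral_mul_const, integral_tent μ S hρ]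

/-- Identifies the weight χ(s)χ(t) of the counting form as a convolution square on G × G. -/
lemma selfConv_tentSq (ρ : ℝ) (w : BorelProd G G) :
    selfConv (BorelProd.measure μ μ) (tentSq μ S ρ) w = weight μ S ρ w.fst * weight μ S ρ w.snd := by
  rw [selfConv, integral_borelProd_of_continuous μ (by fun_prop), weight_eq_selfConv, selfConv,
    selfConv, ← integral_const_mul]
  refine integral_congr_ae (.of_forall fun y => ?_)
  simp only [tentSq, BorelProd.fst_mk, BorelProd.snd_mk, BorelProd.fst_sub, BorelProd.snd_sub]
  rw [← integral_mul_const]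
  refine integral_congr_ae (.of_forall fun x => ?_)
  simp only
  ring

variable {S} {d : ℕ} (hS : S.card ≤ d)
include hS

lemma tentSq_le (hρ : 0 < ρ) (p : BorelProd G G) :
    tentSq μ S ρ p ≤ ((tentMass d ρ)⁻¹) ^ 2 := by
  rw [tentSq, sq]
  have := tentMass_pos d hρ
  exact mul_le_mul (tent_le μ hS hρ _) (tent_le μ hS hρ _) (tent_nonneg μ S ρ _) (by positivity)

lemma abs_tentSq_add_sub_le (hρ : 0 < ρ) (p v : BorelProd G G) :
    |tentSq μ S ρ (p + v) - tentSq μ S ρ p| ≤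
      ((tentMass d ρ)⁻¹) ^ 2 * (ρ⁻¹ * (freqMax S v.fst + freqMax S v.snd)) := by
  have hc := tentMass_pos d hρ
  simp only [tentSq, BorelProd.fst_add, BorelProd.snd_add]
  set a := tent μ S ρ (p.fst + v.fst)
  set a' := tent μ S ρ p.fst
  set b := tent μ S ρ (p.snd + v.snd)
  set b' := tent μ S ρ p.snd
  have h1 : |a - a'| ≤ _ := abs_tent_add_sub_le μ hS hρ p.fst v.fst
  have h2 : |b - b'| ≤ _ := abs_tent_add_sub_le μ hS hρ p.snd v.snd
  have h3 : a' ≤ _ := tent_le μ hS hρ p.fst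
  have h4 : b ≤ _ := tent_le μ hS hρ (p.snd + v.snd)
  have ha : 0 ≤ a' := tent_nonneg μ S ρ _
  have hb : 0 ≤ b := tent_nonneg μ S ρ _
  have e : a * b - a' * b' = (a - a') * b + a' * (b - b') := by ring
  have hf1 := freqMax_nonneg S v.fst
  have hf2 := freqMax_nonneg S v.snd
  rw [e]
  calc _ ≤ |a - a'| * b + a' * |b - b'| := by
        refine (abs_add_le _ _).trans ?_
        rw [abs_mul, abs_mul, abs_of_nonneg ha, abs_of_nonneg hb]
    _ ≤ (tentMass d ρ)⁻¹ * (ρ⁻¹ * freqMax S v.fst) * (tentMass d ρ)⁻¹ +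
        (tentMass d ρ)⁻¹ * ((tentMass d ρ)⁻¹ * (ρ⁻¹ * freqMax S v.snd)) := by
        gcongr
    _ = _ := by ring

omit hS in
lemma norm_freqExp_sub_one_le {ζ : Freq (BorelProd G G)} (h1 : freqFst ζ ∈ S) (h2 : freqSnd ζ ∈ S)
    (hρ : 0 < ρ) {p : BorelProd G G} (hp : tentSq μ S ρ p ≠ 0) :
    ‖freqExp ζ p - 1‖ ≤ 4 * Real.pi * ρ := by
  have e1 := freqMax_lt_of_tent_ne_zero μ hρ (left_ne_zero_of_mul hp)
  have e2 := freqMax_lt_of_tent_ne_zero μ hρ (right_ne_zero_of_mul hp)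
  have e3 := norm_le_freqMax h1 p.fst
  have e4 := norm_le_freqMax h2 p.snd
  have e5 : ‖ζ p‖ ≤ 2 * ρ := by
    rw [freq_eq_add]
    refine (norm_add_le _ _).trans ?_
    linarith
  refine (norm_toCircle_sub_one_le (ζ p)).trans ?_
  calc 2 * Real.pi * ‖ζ p‖ ≤ 2 * Real.pi * (2 * ρ) := by gcongr
    _ = 4 * Real.pi * ρ := by ring

end Square

/-! ### Choice of parameters -/

section Parameters

/-- A bound for the number of frequencies used at spectral threshold `δ`. -/
noncomputable def rankBound (δ : ℝ) : ℕ := 2 * ⌊(δ ^ 2)⁻¹⌋₊ + 1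

/-- The radius of the weight at spectral threshold `δ`. -/
noncomputable def fineRadius (ε δ : ℝ) : ℝ :=
  ε / 256 * tentMass (rankBound δ) (ε / 256) ^ 2 * ε / 32

/-- The spectral threshold following `δ`. -/
noncomputable def nextThreshold (ε δ : ℝ) : ℝ :=
  min δ (ε * tentMass (rankBound δ) (fineRadius ε δ) ^ 4 / 32)

/-- The decreasing sequence of spectral thresholds. -/
noncomputable def threshold (ε : ℝ) (j : ℕ) : ℝ := (nextThreshold ε)^[j] 1

/-- The number of thresholds. -/
noncomputable def numThresholds (ε : ℝ) : ℕ := ⌈1024 / ε ^ 2⌉₊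

/-- The bound for the number of frequencies and for the inverse of the radius. -/
noncomputable def complexityBound (ε : ℝ) : ℝ :=
  ∑ j ∈ Finset.range (numThresholds ε),
    (rankBound (threshold ε j) + (fineRadius ε (threshold ε j))⁻¹)

variable {ε : ℝ}

lemma threshold_succ (ε : ℝ) (j : ℕ) :
    threshold ε (j + 1) = nextThreshold ε (threshold ε j) :=
  Function.iterate_succ_apply' _ _ _

lemma fineRadius_pos (hε : 0 < ε) (δ : ℝ) : 0 < fineRadius ε δ := by
  have := tentMass_pos (rankBound δ) (show 0 < ε / 256 by positivity)
  unfold fineRadius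
  positivity

lemma fineRadius_le (hε : 0 < ε) (hε1 : ε ≤ 1) (δ : ℝ) : fineRadius ε δ ≤ ε := by
  have h0 := tentMass_pos (rankBound δ) (show 0 < ε / 256 by positivity)
  have h1 := tentMass_le_one (rankBound δ) (show 0 < ε / 256 by positivity)
  have h2 : tentMass (rankBound δ) (ε / 256) ^ 2 ≤ 1 := pow_le_one₀ h0.le h1
  unfold fineRadius
  calc ε / 256 * tentMass (rankBound δ) (ε / 256) ^ 2 * ε / 32 ≤ ε / 256 * 1 * 1 / 32 := by gcongr
    _ ≤ ε := by linarith

lemma threshold_pos (hε : 0 < ε) (j : ℕ) : 0 < threshold ε j := by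
  induction j with
  | zero => exact one_pos
  | succ j ih =>
    rw [threshold_succ]
    have := tentMass_pos (rankBound (threshold ε j)) (fineRadius_pos hε (threshold ε j))
    exact lt_min ih (by positivity)

lemma threshold_succ_le (ε : ℝ) (j : ℕ) : threshold ε (j + 1) ≤ threshold ε j := by
  rw [threshold_succ]
  exact min_le_left _ _

lemma le_complexityBound (hε : 0 < ε) {j : ℕ} (hj : j < numThresholds ε) :
    (rankBound (threshold ε j) : ℝ) + (fineRadius ε (threshold ε j))⁻¹ ≤ complexityBound ε :=
  Finset.single_le_sum (f := fun j =>
    (rankBound (threshold ε j) : ℝ) + (fineRadius ε (threshold ε j))⁻¹)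
    (fun _ _ => add_nonneg (Nat.cast_nonneg _) (inv_nonneg.2 (fineRadius_pos hε _).le))
    (Finset.mem_range.2 hj)

lemma numThresholds_pos (hε : 0 < ε) : 0 < numThresholds ε := Nat.ceil_pos.2 (by positivity)

lemma complexityBound_pos (hε : 0 < ε) : 0 < complexityBound ε := by
  refine lt_of_lt_of_le ?_ (le_complexityBound hε (numThresholds_pos hε))
  have := inv_pos.2 (fineRadius_pos hε (threshold ε 0))
  positivity

/-- Pigeonhole: otherwise the telescoping sum of the increments would exceed 1. -/
lemma exists_small_increment (hε : 0 < ε) {a : ℕ → ℝ} (h0 : ∀ j, 0 ≤ a j) (h1 : ∀ j, a j ≤ 1) :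
    ∃ j < numThresholds ε, a (j + 1) - a j ≤ ε ^ 2 / 1024 := by
  by_contra! hc
  have hlt : ∑ j ∈ Finset.range (numThresholds ε), ε ^ 2 / 1024 <
      ∑ j ∈ Finset.range (numThresholds ε), (a (j + 1) - a j) :=
    Finset.sum_lt_sum_of_nonempty (by simpa using (numThresholds_pos hε).ne')
      fun j hj => hc j (Finset.mem_range.1 hj)
  rw [Finset.sum_range_sub, Finset.sum_const, Finset.card_range, nsmul_eq_mul] at hlt
  have h2 : 1024 / ε ^ 2 ≤ numThresholds ε := Nat.le_ceil _
  rw [div_le_iff₀ (by positivity)] at h2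
  linarith [h0 0, h1 (numThresholds ε)]

end Parameters

/-! ### The energy argument for continuous functions -/

section ContinuousCase

variable {G : Type*} [AddCommGroup G] [TopologicalSpace G]
  [IsTopologicalAddGroup G] [CompactSpace G] [T2Space G] [MeasurableSpace G] [BorelSpace G]
  (μ : Measure G) [IsProbabilityMeasure μ] [μ.IsAddHaarMeasure]

/-- The lower bound on the weighted count for continuous functions; the set of frequencies can be
required to contain any given one. -/
theorem exists_weight_of_continuous {ε : ℝ} (hε : 0 < ε) (hε1 : ε ≤ 1)
    (h2 : Function.Surjective fun x : G => (2 : ℕ) • x) {f : BorelProd G G → ℝ}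
    (hf : Continuous f) (hf01 : ∀ p, f p ∈ Set.Icc (0 : ℝ) 1) (ξ₀ : Freq G) :
    ∃ (S : Finset (Freq G)) (ρ : ℝ), ξ₀ ∈ S ∧ (S.card : ℝ) ≤ complexityBound ε ∧
      ρ ∈ Set.Icc (complexityBound ε)⁻¹ ε ∧
      (∫ p, f p ∂BorelProd.measure μ μ) ^ 3 - ε ≤
        ∫ w, ∫ z, f z * f (z + w) * f (z + quarterTurn G w) *
          (weight μ S ρ w.fst * weight μ S ρ w.snd)
            ∂BorelProd.measure μ μ ∂BorelProd.measure μ μ := by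
  classical
  set π := BorelProd.measure μ μ
  have hfc : Continuous fun p => (f p : ℂ) := by fun_prop
  have hfb : ∀ p, ‖(f p : ℂ)‖ ≤ 1 := fun p => by
    rw [Complex.norm_real, Real.norm_of_nonneg (hf01 p).1]
    exact (hf01 p).2
  choose T hTcard hT using fun j => exists_largeSpectrum π hfc hfb (threshold_pos hε j)
  set F := fun ζ => ‖fourierAt π (fun p => (f p : ℂ)) ζ‖ ^ 2
  have hF0 : ∀ ζ, 0 ≤ F ζ := fun ζ => sq_nonneg _
  have hF1 : ∀ j, ∑ ζ ∈ T j, F ζ ≤ 1 := fun j => sum_norm_fourierAt_sq_le π hfc hfb (T j)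
  obtain ⟨j, hj, hinc⟩ := exists_small_increment hε (a := fun j => ∑ ζ ∈ T j, F ζ)
    (fun j => Finset.sum_nonneg fun ζ _ => hF0 ζ) hF1
  set δ := threshold ε j
  set S : Finset (Freq G) := insert ξ₀ ((T j).image freqFst ∪ (T j).image freqSnd)
  set ρ := fineRadius ε δ
  have hρ : 0 < ρ := fineRadius_pos hε δ
  have hρ₀ : 0 < ε / 256 := by positivity
  -- At most δ⁻² large frequencies, two coordinates for each, and one more for ξ₀.
  have hcard : S.card ≤ rankBound δ := by
    have h1 : (T j).card ≤ ⌊(δ ^ 2)⁻¹⌋₊ := Nat.le_floor (hTcard j)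
    have h3 : S.card ≤ _ := Finset.card_insert_le ξ₀ ((T j).image freqFst ∪ (T j).image freqSnd)
    have h4 := Finset.card_union_le ((T j).image freqFst) ((T j).image freqSnd)
    have h5 := Finset.card_image_le (s := T j) (f := freqFst (G := G))
    have h6 := Finset.card_image_le (s := T j) (f := freqSnd (G := G))
    unfold rankBound
    omega
  have hbound := le_complexityBound hε hj
  have hρinv : 0 < ρ⁻¹ := inv_pos.2 hρ
  refine ⟨S, ρ, Finset.mem_insert_self _ _, ?_, ⟨?_, fineRadius_le hε hε1 δ⟩, ?_⟩
  · have : (S.card : ℝ) ≤ rankBound δ := by exact_mod_cast hcard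
    linarith
  · refine inv_le_of_inv_le₀ hρ ?_
    have : (0 : ℝ) ≤ rankBound δ := Nat.cast_nonneg _
    linarith
  have hc := tentMass_pos (rankBound δ) hρ₀
  have hc' := tentMass_pos (rankBound δ) hρ
  have h2' : Function.Surjective fun x : BorelProd G G => (2 : ℕ) • x := fun p => by
    obtain ⟨x, hx⟩ := h2 p.fst
    obtain ⟨y, hy⟩ := h2 p.snd
    exact ⟨BorelProd.mk x y, BorelProd.ext hx hy⟩
  -- The definition of `fineRadius` is made for this: with c the tent mass at radius ε/256,
  -- c⁻²(ε/256)⁻¹ · 4ρ = ε/8.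
  have hsmall : ∀ a b : G, freqMax S a < 2 * ρ → freqMax S b < 2 * ρ →
      ((tentMass (rankBound δ) (ε / 256))⁻¹) ^ 2 * ((ε / 256)⁻¹ * (freqMax S a + freqMax S b)) ≤
        ε / 8 := fun a b ha hb => by
    calc _ ≤ ((tentMass (rankBound δ) (ε / 256))⁻¹) ^ 2 * ((ε / 256)⁻¹ * (2 * ρ + 2 * ρ)) := by
          gcongr
      _ = ε / 8 := by
          simp only [ρ, fineRadius]
          field_simp
          norm_num
  have hmain := trilinear_ge_of_fourierAt π continuous_quarterTurn quarterTurn_quarterTurn h2' hf hf01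
    (N := tentSq μ S (ε / 256)) (N' := tentSq μ S ρ) (continuous_tentSq μ S _)
    (tentSq_nonneg μ S _) (integral_tentSq μ S hρ₀) (continuous_tentSq μ S _)
    (tentSq_nonneg μ S _) (integral_tentSq μ S hρ) (M := ((tentMass (rankBound δ) ρ)⁻¹) ^ 2)
    (σ := ε / 8) (s := ε / 8) (δ := threshold ε (j + 1)) (tentSq_le μ hcard hρ)
    (fun w hw u => by
      rw [selfConv_tentSq] at hw
      have e1 := freqMax_lt_of_weight_ne_zero μ hρ (left_ne_zero_of_mul hw)
      have e2 := freqMax_lt_of_weight_ne_zero μ hρ (right_ne_zero_of_mul hw)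
      refine ⟨(abs_tentSq_add_sub_le μ hcard hρ₀ u w).trans (hsmall _ _ e1 e2),
        (abs_tentSq_add_sub_le μ hcard hρ₀ u _).trans (hsmall _ _ ?_ e1)⟩
      rwa [fst_quarterTurn, freqMax_neg])
    (by positivity) (T (j + 1))
    (by
      have hsub : T j ⊆ T (j + 1) := fun ζ hζ => by
        rw [hT] at hζ ⊢
        exact (threshold_succ_le ε j).trans hζ
      rw [← Finset.sum_sdiff hsub]
      rw [← Finset.sum_sdiff hsub, add_sub_cancel_right] at hinc
      -- On the shell the energy is small and |1 - N̂| ≤ 2, which contributes ε²/256.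
      have hA : ∑ ζ ∈ T (j + 1) \ T j, F ζ *
          ‖1 - fourierAt π (fun z => (tentSq μ S (ε / 256) z : ℂ)) ζ‖ ^ 2 ≤
          ε ^ 2 / 1024 * 2 ^ 2 := by
        refine le_trans ?_ (mul_le_mul_of_nonneg_right hinc (by norm_num))
        rw [Finset.sum_mul]
        refine Finset.sum_le_sum fun ζ _ => mul_le_mul_of_nonneg_left ?_ (hF0 ζ)
        exact pow_le_pow_left₀ (norm_nonneg _) (norm_one_sub_fourierAt_le_two π
          (continuous_tentSq μ S _) (tentSq_nonneg μ S _) (integral_tentSq μ S hρ₀) ζ) 2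
      -- On T j both coordinates of ζ lie in S, so N̂ is close to 1. With π ≤ 4 this contributes
      -- another ε²/256, and the total stays below s² = ε²/64.
      have hB : ∑ ζ ∈ T j, F ζ *
          ‖1 - fourierAt π (fun z => (tentSq μ S (ε / 256) z : ℂ)) ζ‖ ^ 2 ≤
          1 * (4 * Real.pi * (ε / 256)) ^ 2 := by
        refine le_trans ?_ (mul_le_mul_of_nonneg_right (hF1 j) (sq_nonneg _))
        rw [Finset.sum_mul]
        refine Finset.sum_le_sum fun ζ hζ => mul_le_mul_of_nonneg_left ?_ (hF0 ζ)
        refine pow_le_pow_left₀ (norm_nonneg _) (norm_one_sub_fourierAt_le π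
          (continuous_tentSq μ S _) (tentSq_nonneg μ S _) (integral_tentSq μ S hρ₀)
          fun p hp => norm_freqExp_sub_one_le μ ?_ ?_ hρ₀ hp) 2
        · exact Finset.mem_insert_of_mem (Finset.mem_union_left _ (Finset.mem_image_of_mem _ hζ))
        · exact Finset.mem_insert_of_mem (Finset.mem_union_right _ (Finset.mem_image_of_mem _ hζ))
      have hpi : (4 * Real.pi * (ε / 256)) ^ 2 ≤ (4 * 4 * (ε / 256)) ^ 2 := by
        have := Real.pi_le_four
        gcongr
      refine (add_le_add hA hB).trans ?_
      nlinarith)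
    (fun ζ hζ => by
      rw [hT, not_le] at hζ
      exact hζ.le)
    (threshold_pos hε _).le
  have hX : ∀ w, selfConv π (tentSq μ S ρ) w = weight μ S ρ w.fst * weight μ S ρ w.snd :=
    selfConv_tentSq μ S ρ
  simp only [hX] at hmain
  refine le_trans ?_ hmain
  -- The next threshold carries the fourth power of the tent mass at radius ρ, which cancels M². The
  -- total loss is 2 · ε/8 + 3(ε/8 + ε/16) = 13ε/16.
  have hδ' : 2 * threshold ε (j + 1) * (((tentMass (rankBound δ) ρ)⁻¹) ^ 2) ^ 2 ≤ ε / 16 := by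
    have h3 : threshold ε (j + 1) ≤ ε * tentMass (rankBound δ) ρ ^ 4 / 32 := by
      rw [threshold_succ]
      exact min_le_right _ _
    calc _ ≤ 2 * (ε * tentMass (rankBound δ) ρ ^ 4 / 32) *
          (((tentMass (rankBound δ) ρ)⁻¹) ^ 2) ^ 2 := by gcongr
      _ = ε / 16 := by
          field_simp
          norm_num
  linarith

end ContinuousCase

/-! ### The counting form of Borel functions -/

section Borel

/-- Partial integrals of Borel functions are again Borel, which allows Fubini to be iterated. -/
lemma BorelProd.measurable_integral {X Y : Type*} [TopologicalSpace X] [TopologicalSpace Y]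
    [MeasurableSpace X] [BorelSpace X] [MeasurableSpace Y] [BorelSpace Y] [CompactSpace X]
    [T2Space X] (μ : Measure X) [IsProbabilityMeasure μ] [μ.Regular] {f : BorelProd X Y → ℝ}
    (hf : Measurable f) : Measurable fun y => ∫ x, f (BorelProd.mk x y) ∂μ := by
  let κ : ProbabilityTheory.Kernel Y (BorelProd X Y) := ⟨_, BorelProd.measurable_map_mk μ⟩
  have : ProbabilityTheory.IsMarkovKernel κ := ⟨fun y =>
    Measure.isProbabilityMeasure_map (BorelProd.measurable_mk_left y).aemeasurable⟩
  have h : (fun y => ∫ x, f (BorelProd.mk x y) ∂μ) = fun y => ∫ p, f p ∂κ y := funext fun y =>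
    (integral_map (BorelProd.measurable_mk_left y).aemeasurable hf.aestronglyMeasurable).symm
  rw [h]
  exact (hf.stronglyMeasurable.integral_kernel (κ := κ)).measurable

lemma integrable_of_bounded {X : Type*} [MeasurableSpace X] {μ : Measure X} [IsFiniteMeasure μ]
    {f : X → ℝ} (hf : Measurable f) {C : ℝ} (hC : ∀ x, |f x| ≤ C) : Integrable f μ :=
  Integrable.of_bound hf.aestronglyMeasurable C (.of_forall hC)

lemma abs_integral_le_of_bounded {X : Type*} [MeasurableSpace X] {μ : Measure X}
    [IsProbabilityMeasure μ] {f : X → ℝ} {C : ℝ} (hC : ∀ x, |f x| ≤ C) : |∫ x, f x ∂μ| ≤ C := by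
  simpa using norm_integral_le_of_norm_le_const (μ := μ) (f := f) (C := C) (.of_forall hC)

lemma BorelProd.integral_measure_of_bounded {X Y : Type*} [TopologicalSpace X] [TopologicalSpace Y]
    [MeasurableSpace X] [BorelSpace X] [MeasurableSpace Y] [BorelSpace Y] [CompactSpace X]
    [T2Space X] (μ : Measure X) [IsProbabilityMeasure μ] [μ.Regular] (ν : Measure Y)
    [IsProbabilityMeasure ν] {f : BorelProd X Y → ℝ} (hf : Measurable f) {C : ℝ}
    (hC : ∀ p, |f p| ≤ C) :
    ∫ p, f p ∂BorelProd.measure μ ν = ∫ y, ∫ x, f (BorelProd.mk x y) ∂μ ∂ν :=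
  BorelProd.integral_measure μ ν hf.stronglyMeasurable (integrable_of_bounded hf hC)

variable {G : Type*} [AddCommGroup G] [TopologicalSpace G]
  [IsTopologicalAddGroup G] [CompactSpace G] [T2Space G] [MeasurableSpace G] [BorelSpace G]
  (μ : Measure G) [IsProbabilityMeasure μ] [μ.IsAddHaarMeasure]

/-- A fourfold iterated integral of a bounded Borel function, as an integral over pairs of points
of the square. -/
lemma iterated_integral_eq {Φ : BorelProd (BorelProd G G) (BorelProd G G) → ℝ}
    (hΦ : Measurable Φ) {C : ℝ} (hC : ∀ p, |Φ p| ≤ C) :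
    ∫ y, ∫ x, ∫ t, ∫ s, Φ (BorelProd.mk (BorelProd.mk x y) (BorelProd.mk s t)) ∂μ ∂μ ∂μ ∂μ =
      ∫ p, Φ p ∂BorelProd.measure (BorelProd.measure μ μ) (BorelProd.measure μ μ) := by
  -- Reordering coordinates is a continuous group isomorphism, hence preserves Haar probability, and
  -- puts the variables in the order s, t, x, y of the iterated integral.
  let e : BorelProd G (BorelProd G (BorelProd G G)) →+ BorelProd (BorelProd G G) (BorelProd G G) :=
    AddMonoidHom.mk' (fun q => BorelProd.mk q.snd.snd (BorelProd.mk q.fst q.snd.fst))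
      fun _ _ => rfl
  have he : Continuous e := BorelProd.continuous_mk (by fun_prop) (by fun_prop)
  have hes : Function.Surjective e := fun p =>
    ⟨BorelProd.mk p.snd.fst (BorelProd.mk p.snd.snd p.fst), rfl⟩
  have hmp : MeasurePreserving e
      (BorelProd.measure μ (BorelProd.measure μ (BorelProd.measure μ μ)))
      (BorelProd.measure (BorelProd.measure μ μ) (BorelProd.measure μ μ)) :=
    e.measurePreserving he hes (by rw [measure_univ, measure_univ])
  have hm : Measurable fun q => Φ (e q) := hΦ.comp he.measurable
  rw [← hmp.map_eq, integral_map hmp.measurable.aemeasurable hΦ.aestronglyMeasurable]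
  rw [BorelProd.integral_measure_of_bounded μ _ (f := fun q => Φ (e q)) hm (fun q => hC _)]
  have hm1 := BorelProd.measurable_integral μ hm
  have hb1 : ∀ q : BorelProd G (BorelProd G G), |∫ s, Φ (e (BorelProd.mk s q)) ∂μ| ≤ C :=
    fun q => abs_integral_le_of_bounded fun s => hC _
  rw [BorelProd.integral_measure_of_bounded μ _ hm1 hb1]
  have hm2 := BorelProd.measurable_integral μ hm1
  have hb2 : ∀ q : BorelProd G G,
      |∫ t, ∫ s, Φ (e (BorelProd.mk s (BorelProd.mk t q))) ∂μ ∂μ| ≤ C :=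
    fun q => abs_integral_le_of_bounded fun t => hb1 _
  rw [BorelProd.integral_measure_of_bounded μ _ hm2 hb2]
  rfl

lemma continuous_weight (S : Finset (Freq G)) (ρ : ℝ) : Continuous (weight μ S ρ) :=
  continuous_selfConv μ (continuous_tent μ S ρ)

lemma weight_nonneg (S : Finset (Freq G)) (ρ : ℝ) (x : G) : 0 ≤ weight μ S ρ x :=
  selfConv_nonneg μ (tent_nonneg μ S ρ) x

lemma exists_continuous_approx {H : Type*} [TopologicalSpace H] [CompactSpace H] [T2Space H]
    [MeasurableSpace H] [BorelSpace H] (π : Measure H) [IsProbabilityMeasure π] [π.WeaklyRegular]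
    {f : H → ℝ} (hf : Measurable f) (hf01 : ∀ p, f p ∈ Set.Icc (0 : ℝ) 1) {δ : ℝ} (hδ : 0 < δ) :
    ∃ φ : H → ℝ, Continuous φ ∧ (∀ p, φ p ∈ Set.Icc (0 : ℝ) 1) ∧ ∫ p, |f p - φ p| ∂π ≤ δ := by
  have hfb : ∀ p, |f p| ≤ 1 := fun p => by
    rw [abs_of_nonneg (hf01 p).1]
    exact (hf01 p).2
  have hfi : Integrable f π := integrable_of_bounded hf hfb
  obtain ⟨g, hg, hgi⟩ := hfi.exists_boundedContinuous_integral_sub_le hδ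
  -- Clamping an L¹ approximant to [0, 1] does not increase its distance to f, which takes values
  -- there.
  have hclamp : ∀ p, max 0 (min 1 (g p)) ∈ Set.Icc (0 : ℝ) 1 := fun p =>
    ⟨le_max_left _ _, max_le zero_le_one (min_le_left _ _)⟩
  have hcont : Continuous fun p => max 0 (min 1 (g p)) := by fun_prop
  refine ⟨fun p => max 0 (min 1 (g p)), hcont, hclamp, le_trans ?_ hg⟩
  refine integral_mono (hfi.sub hcont.integrable_of_compactSpace).abs (hfi.sub hgi).norm
    fun p => ?_
  obtain ⟨h0, h1⟩ := hf01 p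
  simp only [Real.norm_eq_abs]
  rcases le_total 1 (g p) with h | h
  · rw [min_eq_left h, max_eq_right zero_le_one, abs_of_nonpos (by linarith),
      abs_of_nonpos (by linarith)]
    linarith
  rw [min_eq_right h]
  rcases le_total 0 (g p) with h' | h'
  · rw [max_eq_right h']
  · rw [max_eq_left h', abs_of_nonneg (by linarith), abs_of_nonneg (by linarith)]
    linarith

/-- The integrand of the counting form as a function of a point and a shift. -/
noncomputable def countingIntegrand (X : BorelProd G G → ℝ) (f : BorelProd G G → ℝ)
    (p : BorelProd (BorelProd G G) (BorelProd G G)) : ℝ :=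
  f p.fst * f (p.fst + p.snd) * f (p.fst + quarterTurn G p.snd) * X p.snd

lemma measurable_countingIntegrand {X f : BorelProd G G → ℝ} (hX : Continuous X)
    (hf : Measurable f) : Measurable (countingIntegrand X f) := by
  have hq := continuous_quarterTurn (G := G)
  have m1 : Continuous fun p : BorelProd (BorelProd G G) (BorelProd G G) => p.fst := by fun_prop
  have m2 : Continuous fun p : BorelProd (BorelProd G G) (BorelProd G G) => p.fst + p.snd := by
    fun_prop
  have m3 : Continuous fun p : BorelProd (BorelProd G G) (BorelProd G G) =>
    p.fst + quarterTurn G p.snd := by fun_prop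
  have m4 : Continuous fun p : BorelProd (BorelProd G G) (BorelProd G G) => X p.snd := by fun_prop
  exact (((hf.comp m1.measurable).mul (hf.comp m2.measurable)).mul (hf.comp m3.measurable)).mul
    m4.measurable

lemma abs_countingIntegrand_le {X f : BorelProd G G → ℝ} {C : ℝ} (hX : ∀ w, |X w| ≤ C)
    (hf01 : ∀ p, f p ∈ Set.Icc (0 : ℝ) 1) (p : BorelProd (BorelProd G G) (BorelProd G G)) :
    |countingIntegrand X f p| ≤ C := by
  have h : ∀ p, |f p| ≤ 1 := fun p => by
    rw [abs_of_nonneg (hf01 p).1]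
    exact (hf01 p).2
  rw [countingIntegrand, abs_mul, abs_mul, abs_mul]
  calc _ ≤ 1 * 1 * 1 * C := by
        gcongr
        · exact h _
        · exact h _
        · exact h _
        · exact hX _
    _ = C := by ring

/-- The counting form is Lipschitz for the `L¹` distance. -/
lemma abs_integral_countingIntegrand_sub_le {X f φ : BorelProd G G → ℝ} (hX : Continuous X)
    (hX0 : ∀ w, 0 ≤ X w) (hX1 : ∫ w, X w ∂BorelProd.measure μ μ = 1)
    (hf : Measurable f) (hf01 : ∀ p, f p ∈ Set.Icc (0 : ℝ) 1)
    (hφ : Measurable φ) (hφ01 : ∀ p, φ p ∈ Set.Icc (0 : ℝ) 1) :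
    |∫ p, countingIntegrand X f p ∂BorelProd.measure (BorelProd.measure μ μ)
        (BorelProd.measure μ μ) - ∫ p, countingIntegrand X φ p
        ∂BorelProd.measure (BorelProd.measure μ μ) (BorelProd.measure μ μ)| ≤
      3 * ∫ p, |f p - φ p| ∂BorelProd.measure μ μ := by
  set π := BorelProd.measure μ μ
  obtain ⟨C, hC⟩ : ∃ C, ∀ w, |X w| ≤ C := by
    obtain ⟨C, hC⟩ := isCompact_univ.exists_bound_of_continuousOn hX.continuousOn
    exact ⟨C, fun w => hC w (Set.mem_univ w)⟩
  let D : BorelProd G G → ℝ := fun p => |f p - φ p|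
  have hD : Measurable D := (hf.sub hφ).abs
  have hD1 : ∀ p, |D p| ≤ 1 := fun p => by
    simp only [D, abs_abs, abs_le]
    have h1 := hf01 p
    have h2 := hφ01 p
    constructor <;> linarith [h1.1, h1.2, h2.1, h2.2]
  -- The three slots are the cases τ = 0, 1, J; translation invariance in the first variable removes
  -- the shift and X then integrates to 1.
  have hshift : ∀ τ : BorelProd G G →+ BorelProd G G, Continuous τ →
      Integrable (fun p : BorelProd (BorelProd G G) (BorelProd G G) =>
        D (p.fst + τ p.snd) * X p.snd) (BorelProd.measure π π) ∧
      ∫ p : BorelProd (BorelProd G G) (BorelProd G G), D (p.fst + τ p.snd) * X p.snd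
        ∂BorelProd.measure π π = ∫ p, D p ∂π := by
    intro τ hτ
    have m1 : Continuous fun p : BorelProd (BorelProd G G) (BorelProd G G) => p.fst + τ p.snd := by
      fun_prop
    have m2 : Continuous fun p : BorelProd (BorelProd G G) (BorelProd G G) => X p.snd := by
      fun_prop
    have hm : Measurable fun p : BorelProd (BorelProd G G) (BorelProd G G) =>
      D (p.fst + τ p.snd) * X p.snd := (hD.comp m1.measurable).mul m2.measurable
    have hb : ∀ p : BorelProd (BorelProd G G) (BorelProd G G),
        |D (p.fst + τ p.snd) * X p.snd| ≤ 1 * C := fun p => by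
      rw [abs_mul]
      exact mul_le_mul (hD1 _) (hC _) (abs_nonneg _) zero_le_one
    refine ⟨integrable_of_bounded hm hb, ?_⟩
    rw [BorelProd.integral_measure_of_bounded π π hm hb]
    simp only [BorelProd.fst_mk, BorelProd.snd_mk, integral_mul_const]
    simp only [integral_add_right_eq_self D, integral_const_mul, hX1, mul_one]
  obtain ⟨i1, e1⟩ := hshift 0 continuous_const
  obtain ⟨i2, e2⟩ := hshift (AddMonoidHom.id _) continuous_id
  obtain ⟨i3, e3⟩ := hshift (quarterTurn G) continuous_quarterTurn
  rw [← integral_sub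
    (integrable_of_bounded (measurable_countingIntegrand hX hf) (abs_countingIntegrand_le hC hf01))
    (integrable_of_bounded (measurable_countingIntegrand hX hφ) (abs_countingIntegrand_le hC hφ01))]
  rw [← Real.norm_eq_abs]
  refine (norm_integral_le_of_norm_le ((i1.add i2).add i3) (.of_forall fun p => ?_)).trans_eq ?_
  · simp only [Pi.add_apply, AddMonoidHom.zero_apply, add_zero, AddMonoidHom.id_apply,
      Real.norm_eq_abs, countingIntegrand]
    rw [← sub_mul, abs_mul, abs_of_nonneg (hX0 _), ← add_mul, ← add_mul]
    refine mul_le_mul_of_nonneg_right ?_ (hX0 _)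
    have bd : ∀ a b c a' b' c' : ℝ, a ∈ Set.Icc (0 : ℝ) 1 → b ∈ Set.Icc (0 : ℝ) 1 →
        c ∈ Set.Icc (0 : ℝ) 1 → a' ∈ Set.Icc (0 : ℝ) 1 → b' ∈ Set.Icc (0 : ℝ) 1 →
        c' ∈ Set.Icc (0 : ℝ) 1 → |a * b * c - a' * b' * c'| ≤ |a - a'| + |b - b'| + |c - c'| := by
      intro a b c a' b' c' ha hb hc ha' hb' hc'
      have e : a * b * c - a' * b' * c' =
        (a - a') * (b * c) + (b - b') * (a' * c) + (c - c') * (a' * b') := by ring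
      rw [e]
      have k : ∀ u v w : ℝ, v ∈ Set.Icc (0 : ℝ) 1 → w ∈ Set.Icc (0 : ℝ) 1 →
          |u * (v * w)| ≤ |u| := fun u v w hv hw => by
        rw [abs_mul, abs_of_nonneg (mul_nonneg hv.1 hw.1)]
        exact mul_le_of_le_one_right (abs_nonneg _) (mul_le_one₀ hv.2 hw.1 hw.2)
      refine (abs_add_three _ _ _).trans ?_
      exact add_le_add (add_le_add (k _ _ _ hb hc) (k _ _ _ ha' hc)) (k _ _ _ ha' hb')
    exact bd _ _ _ _ _ _ (hf01 _) (hf01 _) (hf01 _) (hφ01 _) (hφ01 _) (hφ01 _)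
  · rw [integral_add' (i1.add i2) i3, integral_add' i1 i2, e1, e2, e3]
    ring

/-- The lower bound on the weighted count for Borel functions; the set of frequencies can be
required to contain any given one. -/
theorem exists_weight_of_measurable {ε : ℝ} (hε : 0 < ε) (hε1 : ε ≤ 1)
    (h2 : Function.Surjective fun x : G => (2 : ℕ) • x) {f : G × G → ℝ}
    (hf : Measurable[borel (G × G)] f) (hf01 : ∀ p, f p ∈ Set.Icc (0 : ℝ) 1) (ξ₀ : Freq G) :
    ∃ (S : Finset (Freq G)) (ρ : ℝ), ξ₀ ∈ S ∧ (S.card : ℝ) ≤ complexityBound (ε / 2) ∧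
      ρ ∈ Set.Icc (complexityBound (ε / 2))⁻¹ ε ∧
      countingForm μ (weight μ S ρ) f f f ≥ (∫ y, ∫ x, f (x, y) ∂μ ∂μ) ^ 3 - ε := by
  set π := BorelProd.measure μ μ with hπ
  let f' : BorelProd G G → ℝ := fun p => f (p.fst, p.snd)
  have hf' : Measurable f' := hf
  have hf'01 : ∀ p, f' p ∈ Set.Icc (0 : ℝ) 1 := fun p => hf01 _
  have habs : ∀ {g : BorelProd G G → ℝ}, (∀ p, g p ∈ Set.Icc (0 : ℝ) 1) → ∀ p, |g p| ≤ 1 :=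
    fun hg p => by
      rw [abs_of_nonneg (hg p).1]
      exact (hg p).2
  -- An L¹ error ε/12 changes the counting form by at most 3 · ε/12 = ε/4. It costs at most ε/4 in
  -- the cube of the mean, as a² + ab + b² ≤ 3. The continuous case uses the remaining ε/2.
  obtain ⟨φ, hφ, hφ01, hφf⟩ := exists_continuous_approx π hf' hf'01 (show 0 < ε / 12 by positivity)
  obtain ⟨S, ρ, hξ₀, hcard, hρ, hmain⟩ := exists_weight_of_continuous μ (show 0 < ε / 2 by positivity)
    (by linarith) h2 hφ hφ01 ξ₀
  refine ⟨S, ρ, hξ₀, hcard, ⟨hρ.1, hρ.2.trans (by linarith)⟩, ?_⟩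
  have hρ0 : 0 < ρ := (inv_pos.2 (complexityBound_pos (by positivity))).trans_le hρ.1
  let X : BorelProd G G → ℝ := fun w => weight μ S ρ w.fst * weight μ S ρ w.snd
  have hw := continuous_weight μ S ρ
  have hX : Continuous X := by fun_prop
  have hX0 : ∀ w, 0 ≤ X w := fun w => mul_nonneg (weight_nonneg μ S ρ _) (weight_nonneg μ S ρ _)
  have hX1 : ∫ w, X w ∂π = 1 := by
    rw [hπ, integral_borelProd_of_continuous μ hX]
    have := integral_selfConv μ (continuous_tent μ S ρ) (integral_tent μ S hρ0)
    rw [← weight_eq_selfConv] at this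
    simp [X, integral_mul_const, this]
  obtain ⟨C, hC⟩ : ∃ C, ∀ w, |X w| ≤ C := by
    obtain ⟨C, hC⟩ := isCompact_univ.exists_bound_of_continuousOn hX.continuousOn
    exact ⟨C, fun w => hC w (Set.mem_univ w)⟩
  have hcf : countingForm μ (weight μ S ρ) f f f =
      ∫ p, countingIntegrand X f' p ∂BorelProd.measure π π := by
    rw [hπ, ← iterated_integral_eq μ (measurable_countingIntegrand hX hf')
      (abs_countingIntegrand_le hC hf'01), countingForm]
    simp only [countingIntegrand, f', X, BorelProd.fst_mk, BorelProd.snd_mk, BorelProd.fst_add,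
      BorelProd.snd_add, fst_quarterTurn, snd_quarterTurn, ← sub_eq_add_neg, mul_assoc]
  have hcφ : ∫ p, countingIntegrand X φ p ∂BorelProd.measure π π =
      ∫ w, ∫ z, φ z * φ (z + w) * φ (z + quarterTurn G w) *
        (weight μ S ρ w.fst * weight μ S ρ w.snd) ∂π ∂π :=
    BorelProd.integral_measure_of_bounded π π (measurable_countingIntegrand hX hφ.measurable)
      (abs_countingIntegrand_le hC hφ01)
  have hif : ∫ y, ∫ x, f (x, y) ∂μ ∂μ = ∫ p, f' p ∂π :=
    (BorelProd.integral_measure_of_bounded μ μ hf' (habs hf'01)).symm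
  have hdiff := abs_integral_countingIntegrand_sub_le μ hX hX0 hX1 hf' hf'01 hφ.measurable hφ01
  have hfi : Integrable f' π := integrable_of_bounded hf' (habs hf'01)
  have hφi : Integrable φ π := hφ.integrable_of_compactSpace
  have hint : ∫ p, f' p ∂π - ∫ p, φ p ∂π ≤ ε / 12 := by
    rw [← integral_sub hfi hφi]
    refine le_trans (integral_mono (hfi.sub hφi) (hfi.sub hφi).abs fun p => ?_) hφf
    exact le_abs_self _
  have icc : ∀ {g : BorelProd G G → ℝ}, Integrable g π → (∀ p, g p ∈ Set.Icc (0 : ℝ) 1) →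
      ∫ p, g p ∂π ∈ Set.Icc (0 : ℝ) 1 := fun hg hg01 => by
    refine ⟨integral_nonneg fun p => (hg01 p).1, ?_⟩
    have := integral_mono hg (integrable_const (1 : ℝ)) fun p => (hg01 p).2
    simpa using this
  obtain ⟨a0, a1⟩ := icc hfi hf'01
  obtain ⟨b0, b1⟩ := icc hφi hφ01
  rw [hif, hcf]
  rw [← hcφ] at hmain
  have h3 := (abs_le.1 hdiff).1
  set a := ∫ p, f' p ∂π
  set b := ∫ p, φ p ∂π
  have hcube : a ^ 3 - b ^ 3 ≤ ε / 4 := by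
    have e : a ^ 3 - b ^ 3 = (a - b) * (a * a + a * b + b * b) := by ring
    have h4 : a * a + a * b + b * b ≤ 3 := by nlinarith
    have h5 : 0 ≤ a * a + a * b + b * b := by positivity
    rw [e]
    calc _ ≤ ε / 12 * (a * a + a * b + b * b) := by gcongr
      _ ≤ ε / 12 * 3 := by gcongr
      _ = ε / 4 := by ring
  linarith

end Borel

/-! ### Support of the weight on ℤ/Nℤ -/

section Cyclic

/-- The standard frequency `x ↦ x / N` of `ℤ/Nℤ`. -/
noncomputable def cyclicFreq (N : ℕ) [NeZero N] : Freq (ZMod N) :=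
  ⟨ZMod.toAddCircle, continuous_of_discreteTopology⟩

/-- The representative of x nearest to 0 has absolute value N times the norm; being an integer, it
is bounded by the floor. -/
lemma exists_int_of_norm_cyclicFreq_lt {N : ℕ} [NeZero N] {x : ZMod N} {ρ : ℝ}
    (h : ‖cyclicFreq N x‖ < ρ) : ∃ k : ℤ, (k : ZMod N) = x ∧ |k| ≤ ⌊ρ * N⌋ := by
  have hN : (0 : ℝ) < N := by exact_mod_cast NeZero.pos N
  obtain ⟨m, rfl⟩ := ZMod.intCast_surjective x
  have h1 : cyclicFreq N (m : ZMod N) = ((m / N : ℝ) : UnitAddCircle) := ZMod.toAddCircle_intCast m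
  rw [h1, UnitAddCircle.norm_eq] at h
  refine ⟨m - round ((m : ℝ) / N) * N, by simp, ?_⟩
  rw [Int.le_floor]
  push_cast
  have h2 : (m : ℝ) - round ((m : ℝ) / N) * N = ((m : ℝ) / N - round ((m : ℝ) / N)) * N := by
    field_simp
  rw [h2, abs_mul, abs_of_pos hN]
  gcongr

lemma support_weight_subset {N : ℕ} [NeZero N] (μ : Measure (ZMod N)) [μ.IsAddHaarMeasure]
    [IsProbabilityMeasure μ] {S : Finset (Freq (ZMod N))} (hS : cyclicFreq N ∈ S) {ρ : ℝ}
    (hρ : 0 < ρ) : Function.support (weight μ S ρ) ⊆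
      (fun k : ℤ => (k : ZMod N)) '' Set.Icc (-(2 * ⌊ρ * N⌋)) (2 * ⌊ρ * N⌋) := by
  intro x hx
  obtain ⟨y, z, rfl, hy, hz⟩ := exists_of_weight_ne_zero μ hρ hx
  obtain ⟨k, rfl, hk⟩ := exists_int_of_norm_cyclicFreq_lt ((norm_le_freqMax hS y).trans_lt hy)
  obtain ⟨l, rfl, hl⟩ := exists_int_of_norm_cyclicFreq_lt ((norm_le_freqMax hS z).trans_lt hz)
  rw [abs_le] at hk hl
  exact ⟨k + l, ⟨by linarith [hk.1, hl.1], by linarith [hk.2, hl.2]⟩, by simp⟩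

end Cyclic

theorem theorem2 (ε : ℝ) (hε : ε ∈ Set.Ioc (0 : ℝ) 1) :
    ∃ R : ℝ, 0 < R ∧
      (∀ (G : Type*) [AddCommGroup G] [TopologicalSpace G] [IsTopologicalAddGroup G]
          [CompactSpace G] [T2Space G] [MeasurableSpace G] [BorelSpace G]
          (μ : Measure G) [μ.IsAddHaarMeasure] [μ.Regular] [IsProbabilityMeasure μ],
        Function.Surjective (fun x : G => (2 : ℕ) • x) →
        ∀ f : G × G → ℝ, Measurable[borel (G × G)] f → (∀ p, f p ∈ Set.Icc (0 : ℝ) 1) →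
        ∃ (S : Finset (Freq G)) (ρ : ℝ),
          S.Nonempty ∧ (S.card : ℝ) ≤ R ∧ ρ ∈ Set.Icc R⁻¹ ε ∧
          countingForm μ (weight μ S ρ) f f f ≥ (∫ y, ∫ x, f (x, y) ∂μ ∂μ) ^ 3 - ε) ∧
      (∀ (N : ℕ) [NeZero N] (μ : Measure (ZMod N)) [μ.IsAddHaarMeasure] [IsProbabilityMeasure μ],
        Function.Surjective (fun x : ZMod N => (2 : ℕ) • x) →
        ∀ f : ZMod N × ZMod N → ℝ, (∀ p, f p ∈ Set.Icc (0 : ℝ) 1) →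
        ∃ (S : Finset (Freq (ZMod N))) (ρ : ℝ),
          S.Nonempty ∧ (S.card : ℝ) ≤ R ∧ ρ ∈ Set.Icc R⁻¹ ε ∧
          countingForm μ (weight μ S ρ) f f f ≥ (∫ y, ∫ x, f (x, y) ∂μ ∂μ) ^ 3 - ε ∧
          Function.support (weight μ S ρ) ⊆
            (fun k : ℤ => (k : ZMod N)) '' Set.Icc (-(2 * ⌊ρ * N⌋)) (2 * ⌊ρ * N⌋)) := by
  obtain ⟨hε0, hε1⟩ := hε
  have hR : 0 < complexityBound (ε / 2) := complexityBound_pos (by positivity)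
  refine ⟨complexityBound (ε / 2), hR, ?_, ?_⟩
  · intro G _ _ _ _ _ _ _ μ _ _ _ h2 f hf hf01
    -- Prescribing the zero frequency makes S nonempty.
    obtain ⟨S, ρ, hS, hcard, hρ, h⟩ := exists_weight_of_measurable μ hε0 hε1 h2 hf hf01 0
    exact ⟨S, ρ, ⟨0, hS⟩, hcard, hρ, h⟩
  · intro N _ μ _ _ h2 f hf01
    have hf : Measurable[borel (ZMod N × ZMod N)] f := by
      rw [borel_eq_top_of_discrete]
      exact fun _ _ => trivial
    -- Prescribing x ↦ x/N confines the Bohr set to an interval around 0, with the same bound R.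
    obtain ⟨S, ρ, hS, hcard, hρ, h⟩ := exists_weight_of_measurable μ hε0 hε1 h2 hf hf01
      (cyclicFreq N)
    exact ⟨S, ρ, ⟨_, hS⟩, hcard, hρ, h,
      support_weight_subset μ hS ((inv_pos.2 hR).trans_le hρ.1)⟩
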